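/- Let $n\ge 0$ and let $S_n$ be the symmetric group on $[n]$, with one-line notation, simple transpositions $s_i=(i,i{+}1)$, transpositions $t_{ij}=(i,j)$ and Coxeter length $\ell$. A reduced word of $w$ is a word $(a_1,\dots,a_p)$ of minimal length with $w=s_{a_1}\cdots s_{a_p}$. Write $v\lessdot w$ for a cover in Bruhat order, i.e. $w=vt_{ij}$ for some $i,j$ and $\ell(w)=\ell(v)+1$. In the 0-Hecke monoid, $w\circ s_i$ is $ws_i$ if $\ell(ws_i)>\ell(w)$ and $w$ otherwise; $s_i\circ w$ is $s_iw$ if $\ell(s_iw)>\ell(w)$ and $w$ otherwise. Let $\mu=(\mu_1,\dots,\mu_k)$ be a composition of $n$ and cut the one-line notation of $\pi\in S_n$ into consecutive blocks $B_1,\dots,B_k$ of sizes $\mu_1,\dots,\mu_k$. Call $\pi$ a $\mu$-involution ($\pi\in\mathcal I_\mu$) if the standardization of each block is an involution. For $\pi\in\mathcal I_\mu$ and $1\le i<n$ put $\pi\circ_\mu s_i=s_i\circ\pi$ if the values $i,i+1$ lie in different blocks, and $\pi\circ_\mu s_i=s_i\circ\pi\circ s_{m+r}$ if they lie in the same block $B$,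 where $m$ is the number of positions before $B$ and $r$ is the rank of $i$ among the entries of $B$. A reduced $\mu$-word of $\pi$ is a word $(a_1,\dots,a_p)$ of minimal length with $\pi=e\circ_\mu s_{a_1}\circ_\mu\cdots\circ_\mu s_{a_p}$ (evaluated from left to right). The set $\mathcal A_\mu(\pi)$ of $\mu$-atoms of $\pi$ is the set of $w\in S_n$ whose reduced words are reduced $\mu$-words of $\pi$ (if one reduced word of $w$ has this property, then all do). The $\mu$-Bruhat order on $\mathcal I_\mu$ is given by $\pi\le^\mu\tau$ if and only if every reduced $\mu$-word of $\tau$ has a subword (not necessarily of consecutive letters) that is a reduced $\mu$-word of $\pi$; $\pi\lessdot^\mu\tau$ denotes its cover relation. For $i,j\in[n]$ and $\pi\in\mathcal I_\mu$, set $t^\mu_{ij}(\pi)=\tau$ if there are $v\in\mathcal A_\mu(\pi)$ and $\tau\in\mathcal I_\mu$ with $v\lessdot vt_{ij}$ and $vt_{ij}\in\mathcal A_\mu(\tau)$ (such a $\tau$ is unique if it exists), and $t^\mu_{ij}(\pi)=\pi$ otherwise. **Theorem.** Let $\mu$ be a composition of $n$ and let $\pi,\tau\in\mathcal I_\mu$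 with $\pi\lessdot^\mu\tau$. Then $$\mathcal A_\mu(\tau)=\{\,w t_{ij} : w\in\mathcal A_\mu(\pi),\ i,j\in[n],\ t^\mu_{ij}(\pi)=\tau,\ w\lessdot wt_{ij}\,\}.$$ -/

import Mathlib

open Equiv

/-! ## The symmetric group, reduced words, Bruhat covers

Everything is indexed from `0`: positions and values are elements of `Fin n`, and the simple
transpositions are `s_0, …, s_{n-2}`. -/

/-- The simple transposition `s_i = (i, i+1)` of `S_n` (and, by convention, the identity
when `i + 1` is out of range). -/
def simpleTransp (n i : ℕ) : Perm (Fin n) :=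
  if h : i + 1 < n then swap ⟨i, Nat.lt_of_succ_lt h⟩ ⟨i + 1, h⟩ else 1

/-- The product `s_{a_1} ⋯ s_{a_p}` in `S_n`. -/
def wordProd {n : ℕ} (a : List (Fin (n - 1))) : Perm (Fin n) :=
  (a.map fun i => simpleTransp n i).prod

/-- `a ∈ R(w)`: the word `a` is an expression of minimal length for `w`. -/
def IsReducedWord {n : ℕ} (a : List (Fin (n - 1))) (w : Perm (Fin n)) : Prop :=
  wordProd a = w ∧ ∀ b : List (Fin (n - 1)), wordProd b = w → a.length ≤ b.length

/-- The Coxeter length `ℓ(w)`: the least length of an expression for `w`. -/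
noncomputable def permLength {n : ℕ} (w : Perm (Fin n)) : ℕ :=
  sInf {p | ∃ a : List (Fin (n - 1)), wordProd a = w ∧ a.length = p}

/-- The cover relation `v ⋖ w` of (strong) Bruhat order on `S_n`. -/
def BruhatCover {n : ℕ} (v w : Perm (Fin n)) : Prop :=
  (∃ i j : Fin n, w = v * swap i j) ∧ permLength w = permLength v + 1

/-- The product `w ∘ s_i` in the 0-Hecke monoid. -/
noncomputable def heckeRight {n : ℕ} (w : Perm (Fin n)) (i : ℕ) : Perm (Fin n) :=
  if permLength w < permLength (w * simpleTransp n i) then w * simpleTransp n i else w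

/-- The product `s_i ∘ w` in the 0-Hecke monoid. -/
noncomputable def heckeLeft {n : ℕ} (i : ℕ) (w : Perm (Fin n)) : Perm (Fin n) :=
  if permLength w < permLength (simpleTransp n i * w) then simpleTransp n i * w else w

/-! ## `μ`-involutions -/

/-- The standardization of a word `Q` with distinct letters: `Q j` is replaced by its
rank among the letters of `Q`. -/
def standardize {n k : ℕ} (Q : Fin k → Fin n) (j : Fin k) : Fin k :=
  ⟨(Finset.univ.filter fun l => Q l < Q j).card, by
    have h : (Finset.univ.filter fun l => Q l < Q j) ⊂ (Finset.univ : Finset (Fin k)) :=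
      Finset.filter_ssubset.2 ⟨j, Finset.mem_univ j, lt_irrefl _⟩
    simpa using Finset.card_lt_card h⟩

/-- The `b`-th block of the one-line notation of `π`, cut according to `μ`. -/
def block {n : ℕ} (μ : Composition n) (π : Perm (Fin n)) (b : Fin μ.length) :
    Fin (μ.blocksFun b) → Fin n :=
  fun j => π (μ.embedding b j)

/-- `π` is a `μ`-involution: the standardization of each block is an involution. -/
def IsMuInvolution {n : ℕ} (μ : Composition n) (π : Perm (Fin n)) : Prop :=
  ∀ b : Fin μ.length, Function.Involutive (standardize (block μ π b))

/-- The set `I_μ` of `μ`-involutions. -/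
abbrev MuInvolution {n : ℕ} (μ : Composition n) : Type :=
  {π : Perm (Fin n) // IsMuInvolution μ π}

/-- The (index of the) block of `π` containing the value `a`. -/
def blockOf {n : ℕ} (μ : Composition n) (π : Perm (Fin n)) (a : Fin n) : Fin μ.length :=
  μ.index (π.symm a)

/-- The position in `[n]` given by the relative value of `a` within its block `B`: if `B` occupies
the positions `m + 0, m + 1, …` and `a` has rank `r` (from `0`) in `B`, this is `m + r`. -/
def relPosition {n : ℕ} (μ : Composition n) (π : Perm (Fin n)) (a : Fin n) : Fin n :=
  μ.embedding (blockOf μ π a)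
    (standardize (block μ π (blockOf μ π a)) (μ.invEmbedding (π.symm a)))

/-- The action `π ∘_μ s_i` of a generator of the 0-Hecke monoid: `s_i ∘ π` if the values `i, i+1`
lie in different blocks, and otherwise `s_i ∘ π ∘ s_r`, where `r` is the relative value of `i`
in the common block (shifted to the positions of this block). -/
noncomputable def muAct {n : ℕ} (μ : Composition n) (π : Perm (Fin n)) (i : Fin (n - 1)) :
    Perm (Fin n) :=
  if blockOf μ π ⟨i, by omega⟩ = blockOf μ π ⟨i + 1, by omega⟩ then
    heckeRight (heckeLeft i π) (relPosition μ π ⟨i, by omega⟩)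
  else heckeLeft i π

/-- `e ∘_μ s_{a_1} ∘_μ ⋯ ∘_μ s_{a_p}`, evaluated from left to right. -/
noncomputable def muWordProd {n : ℕ} (μ : Composition n) (a : List (Fin (n - 1))) :
    Perm (Fin n) :=
  a.foldl (muAct μ) 1

/-- `a ∈ R_μ(π)`: `a` is a `μ`-word for `π` of minimal length. -/
def IsReducedMuWord {n : ℕ} (μ : Composition n) (a : List (Fin (n - 1)))
    (π : MuInvolution μ) : Prop :=
  muWordProd μ a = π ∧
    ∀ b : List (Fin (n - 1)), muWordProd μ b = π → a.length ≤ b.length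

/-- The set `A_μ(π)` of `μ`-atoms of `π`: the permutations whose reduced words make up the set
`R_μ(π)` of reduced `μ`-words. -/
def muAtoms {n : ℕ} (μ : Composition n) (π : MuInvolution μ) : Set (Perm (Fin n)) :=
  {w | ∃ a : List (Fin (n - 1)), IsReducedWord a w ∧ IsReducedMuWord μ a π}

/-! ## `μ`-Bruhat order and the operators `t^μ_{ij}` -/

/-- `μ`-Bruhat order on `I_μ`: every reduced `μ`-word of `τ` has a subword that is a reduced
`μ`-word of `π`. -/
def MuBruhatLE {n : ℕ} (μ : Composition n) (π τ : MuInvolution μ) : Prop :=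
  ∀ a : List (Fin (n - 1)), IsReducedMuWord μ a τ →
    ∃ a' : List (Fin (n - 1)), a'.Sublist a ∧ IsReducedMuWord μ a' π

/-- The cover relation `π ⋖^μ τ`: `π <^μ τ`, with nothing strictly between. -/
def MuBruhatCover {n : ℕ} (μ : Composition n) (π τ : MuInvolution μ) : Prop :=
  MuBruhatLE μ π τ ∧ π ≠ τ ∧
    ∀ σ : MuInvolution μ, MuBruhatLE μ π σ → MuBruhatLE μ σ τ → σ = π ∨ σ = τ

open Classical in
/-- The operator `t^μ_{ij} : I_μ → I_μ`. If `v ⋖ v t_{ij}` for some `μ`-atom `v` of `π` such that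
`v t_{ij}` is a `μ`-atom of some `μ`-involution `τ`, then `t^μ_{ij}(π) = τ`; otherwise
`t^μ_{ij}(π) = π`. -/
noncomputable def muTransp {n : ℕ} (μ : Composition n) (i j : Fin n) (π : MuInvolution μ) :
    MuInvolution μ :=
  if h : ∃ τ : MuInvolution μ, ∃ v ∈ muAtoms μ π,
      BruhatCover v (v * swap i j) ∧ v * swap i j ∈ muAtoms μ τ
  then h.choose else π

/-! A `μ`-involution is encoded as a `BlockState` (`muState`): every value is coloured by its block,
and `star` sends it to its partner under the involution of that block. On valid states a generator
is a 0-Hecke step on rows and columns at once, so it changes the rank function `BlockState.rank` by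
one monotone max-plus operator that does not depend on the state (`rank_act`). Ordering states by
reversed ranks yields a lifting property, hence the subword property (`Strict.exists_sublist`,
`run_le_run_of_sublist`) and the existence of elements of corank one (`Strict.exists_corank_one`).
So reduced words for the two sides of a cover differ in length by one. Given an atom `u` of `τ`,
some reduced word of `u` loses one letter and becomes a reduced word of an atom of `π`; deleting a
letter is right multiplication by a transposition. This is the inclusion from left to right.

For the other inclusion, `t^μ_ij(π) = τ ≠ π` is witnessed by some atom `v` of `π`, and every atom
`w` of `π` covered by `w t_ij` has to lead to the same `τ`. Max-plus linearity shows that the rank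
at `(β, p, q)` of the state reached by `w` is the maximum, over the cuts `k` of block `β`, of `m β +
#{x < p : w x < k} + #{x < q : w x < k} - k` (`MaxForm`). Exchanging `i` and `j` lowers this
function only on the window `w i < k ≤ w j`. Atoms satisfy the order conditions `IsAtom`; for `p ≤
q` these force every maximizing cut to come after all low cycles and before all high ones, and they
control the values outside the window. The resulting rank, `coverRank`, involves only the state, `i`
and `j` (`IsAtom.rank_mul_swap`). Hence `w t_ij` reaches `τ`, and comparing lengths makes it an
atom. -/

/-! ## Simple transpositions and inversions -/

/-- The smaller of the two values exchanged by the `i`-th simple transposition. -/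
def lowVal {n : ℕ} (i : Fin (n - 1)) : Fin n := ⟨i, by omega⟩

/-- The larger of the two values exchanged by the `i`-th simple transposition. -/
def highVal {n : ℕ} (i : Fin (n - 1)) : Fin n := ⟨i + 1, by omega⟩

/-- The `i`-th simple transposition as a swap. -/
def adjSwap {n : ℕ} (i : Fin (n - 1)) : Perm (Fin n) := swap (lowVal i) (highVal i)

section
variable {n : ℕ}

@[simp] lemma val_lowVal (i : Fin (n - 1)) : (lowVal i : ℕ) = i := rfl

@[simp] lemma val_highVal (i : Fin (n - 1)) : (highVal i : ℕ) = i + 1 := rfl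

lemma lowVal_lt_highVal (i : Fin (n - 1)) : lowVal i < highVal i := by
  simp [Fin.lt_def]

lemma lowVal_ne_highVal (i : Fin (n - 1)) : lowVal i ≠ highVal i :=
  (lowVal_lt_highVal i).ne

lemma simpleTransp_eq (i : Fin (n - 1)) : simpleTransp n i = adjSwap i := by
  have : (i : ℕ) + 1 < n := by omega
  simp [simpleTransp, this, adjSwap, lowVal, highVal]

@[simp] lemma adjSwap_lowVal (i : Fin (n - 1)) : adjSwap i (lowVal i) = highVal i :=
  swap_apply_left _ _

@[simp] lemma adjSwap_highVal (i : Fin (n - 1)) : adjSwap i (highVal i) = lowVal i :=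
  swap_apply_right _ _

lemma adjSwap_of_ne {i : Fin (n - 1)} {x : Fin n} (h₀ : x ≠ lowVal i) (h₁ : x ≠ highVal i) :
    adjSwap i x = x :=
  swap_apply_of_ne_of_ne h₀ h₁

@[simp] lemma adjSwap_mul_self (i : Fin (n - 1)) : adjSwap i * adjSwap i = 1 :=
  swap_mul_self _ _

@[simp] lemma adjSwap_apply_apply (i : Fin (n - 1)) (x : Fin n) :
    adjSwap i (adjSwap i x) = x :=
  swap_apply_self _ _ _

@[simp] lemma adjSwap_inv (i : Fin (n - 1)) : (adjSwap i)⁻¹ = adjSwap i :=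
  swap_inv _ _

lemma adjSwap_cases (i : Fin (n - 1)) (x : Fin n) :
    (x = lowVal i ∧ adjSwap i x = highVal i) ∨ (x = highVal i ∧ adjSwap i x = lowVal i) ∨
      (x ≠ lowVal i ∧ x ≠ highVal i ∧ adjSwap i x = x) := by
  by_cases h₀ : x = lowVal i
  · left; simp [h₀]
  by_cases h₁ : x = highVal i
  · right; left; simp [h₁]
  exact Or.inr (Or.inr ⟨h₀, h₁, adjSwap_of_ne h₀ h₁⟩)

lemma adjSwap_lt_adjSwap {i : Fin (n - 1)} {x y : Fin n} (h : x < y)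
    (hne : ¬(x = lowVal i ∧ y = highVal i)) : adjSwap i x < adjSwap i y := by
  rcases adjSwap_cases i x with ⟨hx, ex⟩ | ⟨hx, ex⟩ | ⟨hx, hx', ex⟩ <;>
  rcases adjSwap_cases i y with ⟨hy, ey⟩ | ⟨hy, ey⟩ | ⟨hy, hy', ey⟩ <;>
  simp only [ex, ey, Fin.lt_def, Fin.ext_iff, val_lowVal, val_highVal, ne_eq] at * <;> omega

lemma adjSwap_val_lt {i : Fin (n - 1)} {x : Fin n} {p : ℕ} (hp : p ≠ i + 1) :
    (adjSwap i x : ℕ) < p ↔ (x : ℕ) < p := by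
  rcases adjSwap_cases i x with ⟨hx, ex⟩ | ⟨hx, ex⟩ | ⟨hx, hx', ex⟩ <;>
  simp only [ex, Fin.ext_iff, val_lowVal, val_highVal, ne_eq] at * <;> omega

/-- The set of inversions of a permutation. -/
def invSet (w : Perm (Fin n)) : Finset (Fin n × Fin n) :=
  Finset.univ.filter fun z => z.1 < z.2 ∧ w z.2 < w z.1

/-- The number of inversions of a permutation. -/
def invCount (w : Perm (Fin n)) : ℕ := (invSet w).card

lemma mem_invSet {w : Perm (Fin n)} {z : Fin n × Fin n} :
    z ∈ invSet w ↔ z.1 < z.2 ∧ w z.2 < w z.1 := by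
  simp [invSet]

@[simp] lemma invCount_one : invCount (1 : Perm (Fin n)) = 0 := by
  refine Finset.card_eq_zero.2 (Finset.eq_empty_of_forall_notMem fun z hz => ?_)
  obtain ⟨h₁, h₂⟩ := mem_invSet.1 hz
  exact lt_asymm h₁ h₂

/-- Applying `s_i` to both coordinates matches the inversions of `w` with those of `w s_i` other
than the new pair `(i, i+1)`. -/
lemma invCount_mul_adjSwap {w : Perm (Fin n)} {i : Fin (n - 1)}
    (h : w (lowVal i) < w (highVal i)) : invCount (w * adjSwap i) = invCount w + 1 := by
  have hmem : (lowVal i, highVal i) ∈ invSet (w * adjSwap i) := by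
    simp [mem_invSet, lowVal_lt_highVal, h]
  have hE : (invSet (w * adjSwap i)).erase (lowVal i, highVal i) =
      (invSet w).map ((adjSwap i).prodCongr (adjSwap i)).toEmbedding := by
    ext ⟨x, y⟩
    simp only [Finset.mem_erase, mem_invSet, Finset.mem_map_equiv, Perm.mul_apply, ne_eq,
      Prod.mk.injEq, Equiv.prodCongr_symm, Equiv.prodCongr_apply, Prod.map]
    have e : (adjSwap i).symm = adjSwap i := adjSwap_inv i
    rw [e]
    constructor
    · rintro ⟨hne, hlt, hw⟩
      exact ⟨adjSwap_lt_adjSwap hlt hne, hw⟩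
    · rintro ⟨hlt, hw⟩
      have hne : ¬(adjSwap i x = lowVal i ∧ adjSwap i y = highVal i) := by
        rintro ⟨h₀, h₁⟩
        rw [h₀, h₁] at hw
        exact lt_asymm h hw
      have := adjSwap_lt_adjSwap hlt hne
      rw [adjSwap_apply_apply, adjSwap_apply_apply] at this
      refine ⟨?_, this, hw⟩
      rintro ⟨rfl, rfl⟩
      simp at hlt
      exact lt_asymm hlt (lowVal_lt_highVal i)
  have := Finset.card_erase_add_one hmem
  rw [hE, Finset.card_map] at this
  exact this.symm

lemma invCount_mul_adjSwap_of_gt {w : Perm (Fin n)} {i : Fin (n - 1)}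
    (h : w (highVal i) < w (lowVal i)) : invCount (w * adjSwap i) + 1 = invCount w := by
  have := invCount_mul_adjSwap (w := w * adjSwap i) (i := i) (by simpa using h)
  rw [mul_assoc, adjSwap_mul_self, mul_one] at this
  exact this.symm

lemma exists_descent {w : Perm (Fin n)} (h : w ≠ 1) :
    ∃ i : Fin (n - 1), w (highVal i) < w (lowVal i) := by
  by_contra! hcon
  apply h
  have hmono : StrictMono w := by
    cases n with
    | zero => exact fun x => x.elim0
    | succ m =>
      refine Fin.strictMono_iff_lt_succ.2 fun i => ?_
      refine lt_of_le_of_ne (hcon i) fun e => ?_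
      exact lowVal_ne_highVal _ (w.injective e)
  have := (hmono.range_inj strictMono_id).1 (by simp [w.surjective.range_eq])
  exact Equiv.ext fun x => congrFun this x

lemma wordProd_append_singleton (a : List (Fin (n - 1))) (i : Fin (n - 1)) :
    wordProd (a ++ [i]) = wordProd a * adjSwap i := by
  simp [wordProd, simpleTransp_eq]

@[simp] lemma wordProd_nil : wordProd ([] : List (Fin (n - 1))) = 1 := rfl

lemma invCount_wordProd_le (a : List (Fin (n - 1))) : invCount (wordProd a) ≤ a.length := by
  induction a using List.reverseRecOn with
  | nil => simp
  | append_singleton a i ih =>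
    rw [wordProd_append_singleton, List.length_append, List.length_singleton]
    rcases lt_or_gt_of_ne ((wordProd a).injective.ne (lowVal_ne_highVal i)) with h | h
    · rw [invCount_mul_adjSwap h]; omega
    · have := invCount_mul_adjSwap_of_gt h; omega

lemma exists_word (w : Perm (Fin n)) :
    ∃ a : List (Fin (n - 1)), wordProd a = w ∧ a.length = invCount w := by
  induction h : invCount w generalizing w with
  | zero =>
    refine ⟨[], ?_, rfl⟩
    by_contra hne
    obtain ⟨i, hi⟩ := exists_descent (w := w) (fun e => hne (by simp [e]))
    have := invCount_mul_adjSwap_of_gt hi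
    omega
  | succ k ih =>
    have hne : w ≠ 1 := by rintro rfl; simp at h
    obtain ⟨i, hi⟩ := exists_descent hne
    have := invCount_mul_adjSwap_of_gt hi
    obtain ⟨a, ha, hl⟩ := ih (w * adjSwap i) (by omega)
    exact ⟨a ++ [i], by rw [wordProd_append_singleton, ha, mul_assoc, adjSwap_mul_self, mul_one],
      by simp [hl]⟩

lemma permLength_eq (w : Perm (Fin n)) : permLength w = invCount w := by
  apply le_antisymm
  · exact Nat.sInf_le (exists_word w)
  · obtain ⟨a, ha, hl⟩ := Nat.sInf_mem (s := {p | ∃ a : List (Fin (n - 1)),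
      wordProd a = w ∧ a.length = p}) ⟨_, exists_word w⟩
    rw [permLength, ← hl, ← ha]
    exact invCount_wordProd_le a

lemma isReducedWord_iff {a : List (Fin (n - 1))} {w : Perm (Fin n)} :
    IsReducedWord a w ↔ wordProd a = w ∧ a.length = invCount w := by
  constructor
  · rintro ⟨h, hmin⟩
    obtain ⟨b, hb, hl⟩ := exists_word w
    refine ⟨h, le_antisymm (hl ▸ hmin b hb) ?_⟩
    rw [← h]
    exact invCount_wordProd_le a
  · rintro ⟨h, hl⟩
    refine ⟨h, fun b hb => ?_⟩
    rw [hl, ← hb]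
    exact invCount_wordProd_le b

/-- Induction on `j - i`, since `t_ij` is the conjugate of `t_{i,j-1}` by `s_{j-1}`. The two
conjugating factors change the count by one each, and whenever the first lowers it the last raises
it. -/
lemma invCount_lt_mul_swap {w : Perm (Fin n)} {i j : Fin n} (hij : i < j) (h : w i < w j) :
    invCount w < invCount (w * swap i j) := by
  obtain ⟨d, hd⟩ : ∃ d, (j : ℕ) = i + d + 1 := ⟨j - i - 1, by rw [Fin.lt_def] at hij; omega⟩
  induction d generalizing w j with
  | zero =>
    have hj := j.isLt
    let k : Fin (n - 1) := ⟨i, by omega⟩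
    have e₀ : i = lowVal k := Fin.ext rfl
    have e₁ : j = highVal k := Fin.ext hd
    rw [e₀, e₁] at h ⊢
    have := invCount_mul_adjSwap h
    rw [adjSwap] at this
    omega
  | succ d ih =>
    have hj := j.isLt
    let k : Fin (n - 1) := ⟨i + d + 1, by omega⟩
    have e₁ : j = highVal k := Fin.ext hd
    have hi₀ : i ≠ lowVal k := by rw [ne_eq, Fin.ext_iff, val_lowVal]; simp only [k]; omega
    have hi₁ : i ≠ highVal k := by rw [← e₁]; exact hij.ne
    have hlt : i < lowVal k := by rw [Fin.lt_def, val_lowVal]; simp only [k]; omega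
    have hconj : swap i j = adjSwap k * swap i (lowVal k) * adjSwap k := by
      have := swap_apply_apply (adjSwap k) i (lowVal k)
      rw [adjSwap_of_ne hi₀ hi₁, adjSwap_lowVal, adjSwap_inv, ← e₁] at this
      exact this
    have hstep := ih (w := w * adjSwap k) (j := lowVal k) hlt
      (by rw [Perm.mul_apply, Perm.mul_apply, adjSwap_of_ne hi₀ hi₁, adjSwap_lowVal, ← e₁]; exact h)
      (by simp [k])
    rw [hconj, ← mul_assoc, ← mul_assoc]
    set v := w * adjSwap k * swap i (lowVal k) with hv
    have v₀ : v (lowVal k) = w i := by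
      simp [hv, adjSwap_of_ne hi₀ hi₁]
    have v₁ : v (highVal k) = w (lowVal k) := by
      rw [hv, Perm.mul_apply, swap_apply_of_ne_of_ne hi₁.symm (lowVal_ne_highVal k).symm]
      simp
    rcases lt_or_gt_of_ne (w.injective.ne (lowVal_ne_highVal k)) with hk | hk
    · have h₁ := invCount_mul_adjSwap hk
      rcases lt_or_gt_of_ne (v.injective.ne (lowVal_ne_highVal k)) with hk' | hk'
      · have h₂ := invCount_mul_adjSwap hk'
        omega
      · have h₂ := invCount_mul_adjSwap_of_gt hk'
        omega
    · have h₁ := invCount_mul_adjSwap_of_gt hk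
      have h₂ := invCount_mul_adjSwap (w := v) (i := k) (by
        rw [v₀, v₁]; exact (h.trans_eq (congrArg w e₁)).trans hk)
      omega

/-- A Bruhat cover exchanges an ascending pair of values with nothing in between. -/
lemma BruhatCover.ascent {w : Perm (Fin n)} {i j : Fin n} (hij : i < j)
    (h : BruhatCover w (w * swap i j)) :
    w i < w j ∧ ∀ e, i < e → e < j → ¬(w i < w e ∧ w e < w j) := by
  have hl := h.2
  rw [permLength_eq, permLength_eq] at hl
  constructor
  · by_contra hcon
    have hlt : w j < w i := lt_of_le_of_ne (not_lt.1 hcon) (w.injective.ne hij.ne')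
    have := invCount_lt_mul_swap (w := w * swap i j) hij (by simpa using hlt)
    rw [mul_assoc, swap_mul_self, mul_one] at this
    omega
  · rintro e hie hej ⟨h₁, h₂⟩
    -- `t_ij = t_ej t_ie t_ej`, and each factor adds inversions: a gain of at least 3, against 1 for
    -- a cover.
    have s₁ := invCount_lt_mul_swap hej h₂
    have s₂ := invCount_lt_mul_swap (w := w * swap e j) hie (by
      simpa [swap_apply_of_ne_of_ne hie.ne hij.ne] using h₁.trans h₂)
    have s₃ := invCount_lt_mul_swap (w := w * swap e j * swap i e) hej (by
      simpa [swap_apply_of_ne_of_ne hie.ne hij.ne, swap_apply_of_ne_of_ne hij.ne' hej.ne']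
        using h₁)
    have : w * swap e j * swap i e * swap e j = w * swap i j := by
      rw [mul_assoc, mul_assoc]
      congr 1
      have := swap_apply_apply (swap e j) i e
      rw [swap_apply_of_ne_of_ne hie.ne hij.ne, swap_apply_left, swap_inv] at this
      rw [this, mul_assoc]
    rw [this] at s₃
    omega

end

/-! ## Threshold counts -/

section
variable {n : ℕ}

open Classical in
/-- The number of `x < p` satisfying `κ`, as an integer. -/
noncomputable def countBelow (κ : Fin n → Prop) (p : ℕ) : ℤ :=
  ∑ x : Fin n, if (x : ℕ) < p ∧ κ x then 1 else 0

lemma countBelow_succ (κ : Fin n → Prop) [DecidablePred κ] (x : Fin n) :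
    countBelow κ (x + 1) = countBelow κ x + if κ x then 1 else 0 := by
  classical
  have : (if κ x then 1 else 0 : ℤ) = ∑ y : Fin n, if y = x then (if κ x then 1 else 0) else 0 := by
    simp
  rw [this, countBelow, countBelow, ← Finset.sum_add_distrib]
  refine Finset.sum_congr rfl fun y _ => ?_
  by_cases hy : y = x
  · subst hy; simp
  · have : (y : ℕ) ≠ x := fun e => hy (Fin.ext e)
    have h' : (y : ℕ) < x + 1 ↔ (y : ℕ) < x := by omega
    simp [h', hy]

lemma countBelow_comp_equiv (κ : Fin n → Prop) [DecidablePred κ] (e : Perm (Fin n)) (p : ℕ) :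
    countBelow (fun y => κ (e⁻¹ y)) p = ∑ x : Fin n, if (e x : ℕ) < p ∧ κ x then 1 else 0 := by
  classical
  rw [countBelow, ← Equiv.sum_comp e]
  refine Finset.sum_congr rfl fun y _ => ?_
  simp

lemma countBelow_adjSwap_of_ne (κ : Fin n → Prop) {i : Fin (n - 1)} {p : ℕ} (hp : p ≠ i + 1) :
    countBelow (fun x => κ (adjSwap i x)) p = countBelow κ p := by
  classical
  have := countBelow_comp_equiv κ (adjSwap i) p
  rw [adjSwap_inv] at this
  rw [this, countBelow]
  exact Finset.sum_congr rfl fun y _ => by simp only [adjSwap_val_lt hp]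

lemma countBelow_add_one (κ : Fin n → Prop) [DecidablePred κ] (i : Fin (n - 1)) :
    countBelow κ (i + 1) = countBelow κ i + if κ (lowVal i) then 1 else 0 :=
  countBelow_succ κ (lowVal i)

lemma countBelow_add_two (κ : Fin n → Prop) [DecidablePred κ] (i : Fin (n - 1)) :
    countBelow κ (i + 2) = countBelow κ (i + 1) + if κ (highVal i) then 1 else 0 :=
  countBelow_succ κ (highVal i)

lemma countBelow_adjSwap_self (κ : Fin n → Prop) [DecidablePred κ] (i : Fin (n - 1)) :
    countBelow (fun x => κ (adjSwap i x)) (i + 1) =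
      countBelow κ i + if κ (highVal i) then 1 else 0 := by
  rw [countBelow_add_one, countBelow_adjSwap_of_ne κ (by omega), adjSwap_lowVal]

/-- The effect of an ascending simple transposition on threshold counts. -/
def raiseAt (i : ℕ) (f : ℕ → ℤ) (p : ℕ) : ℤ :=
  if p = i + 1 then max (f i) (f (i + 2) - 1) else f p

/-- The effect of a descending simple transposition on threshold counts. -/
def lowerAt (i : ℕ) (f : ℕ → ℤ) (p : ℕ) : ℤ :=
  if p = i + 1 then min (f (i + 2)) (f i + 1) else f p

lemma raiseAt_mono {i : ℕ} {f g : ℕ → ℤ} (h : ∀ p, f p ≤ g p) (p : ℕ) :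
    raiseAt i f p ≤ raiseAt i g p := by
  have h₁ := h i
  have h₂ := h (i + 2)
  have h₃ := h p
  unfold raiseAt
  split_ifs <;> omega

lemma lowerAt_mono {i : ℕ} {f g : ℕ → ℤ} (h : ∀ p, f p ≤ g p) (p : ℕ) :
    lowerAt i f p ≤ lowerAt i g p := by
  have h₁ := h i
  have h₂ := h (i + 2)
  have h₃ := h p
  unfold lowerAt
  split_ifs <;> omega

lemma raiseAt_add_const (i : ℕ) (f : ℕ → ℤ) (c : ℤ) (p : ℕ) :
    raiseAt i (fun p => f p + c) p = raiseAt i f p + c := by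
  simp only [raiseAt]; split_ifs <;> omega

lemma lowerAt_add_const (i : ℕ) (f : ℕ → ℤ) (c : ℤ) (p : ℕ) :
    lowerAt i (fun p => f p + c) p = lowerAt i f p + c := by
  simp only [lowerAt]; split_ifs <;> omega

/-- Only the threshold `i+1` is affected. If `a, b ∈ {0, 1}` are the truth values of `κ` at `i, i+1`
and `b ≤ a`, the new count there is `f i + b`, and `b = max 0 (a + b - 1)`. -/
lemma countBelow_adjSwap_eq_raiseAt {κ : Fin n → Prop} {i : Fin (n - 1)}
    (h : κ (highVal i) → κ (lowVal i)) (p : ℕ) :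
    countBelow (fun x => κ (adjSwap i x)) p = raiseAt i (countBelow κ) p := by
  classical
  unfold raiseAt
  split_ifs with hp
  · subst hp
    rw [countBelow_adjSwap_self, countBelow_add_two, countBelow_add_one]
    split_ifs <;> first | omega | tauto
  · exact countBelow_adjSwap_of_ne κ hp

/-- With `a ≤ b` instead, `max 0 (a + b - 1) = a`: raising does nothing on a descent, as in the
0-Hecke monoid. -/
lemma raiseAt_countBelow {κ : Fin n → Prop} {i : Fin (n - 1)}
    (h : κ (lowVal i) → κ (highVal i)) (p : ℕ) :
    raiseAt i (countBelow κ) p = countBelow κ p := by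
  classical
  unfold raiseAt
  split_ifs with hp
  · subst hp
    rw [countBelow_add_two, countBelow_add_one]
    split_ifs <;> first | omega | tauto
  · rfl

lemma countBelow_adjSwap_eq_lowerAt {κ : Fin n → Prop} {i : Fin (n - 1)}
    (h : κ (lowVal i) → κ (highVal i)) (p : ℕ) :
    countBelow (fun x => κ (adjSwap i x)) p = lowerAt i (countBelow κ) p := by
  classical
  unfold lowerAt
  split_ifs with hp
  · subst hp
    rw [countBelow_adjSwap_self, countBelow_add_two, countBelow_add_one]
    split_ifs <;> first | omega | tauto
  · exact countBelow_adjSwap_of_ne κ hp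

lemma lowerAt_countBelow {κ : Fin n → Prop} {i : Fin (n - 1)}
    (h : κ (highVal i) → κ (lowVal i)) (p : ℕ) :
    lowerAt i (countBelow κ) p = countBelow κ p := by
  classical
  unfold lowerAt
  split_ifs with hp
  · subst hp
    rw [countBelow_add_two, countBelow_add_one]
    split_ifs <;> first | omega | tauto
  · rfl

lemma countBelow_adjSwap_le {κ : Fin n → Prop} {i : Fin (n - 1)}
    (h : κ (highVal i) → κ (lowVal i)) (p : ℕ) :
    countBelow (fun x => κ (adjSwap i x)) p ≤ countBelow κ p := by
  classical
  by_cases hp : p = i + 1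
  · subst hp
    rw [countBelow_adjSwap_self, countBelow_add_one]
    split_ifs <;> first | omega | tauto
  · exact (countBelow_adjSwap_of_ne κ hp).le

end

/-! ## Values coloured by blocks, with a permutation preserving the blocks -/

/-- A colouring of the values by block indices, together with a permutation of the values. -/
@[ext]
structure BlockState (n : ℕ) where
  blk : Fin n → ℕ
  star : Perm (Fin n)

namespace BlockState
variable {n : ℕ}

/-- The permutation is an involution preserving each block. -/
structure Valid (σ : BlockState n) : Prop where
  star_star : ∀ x, σ.star (σ.star x) = x
  blk_star : ∀ x, σ.blk (σ.star x) = σ.blk x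

/-- The key (block, partner) of `i` is smaller than that of `i + 1`. -/
def Asc (σ : BlockState n) (i : Fin (n - 1)) : Prop :=
  σ.blk (lowVal i) < σ.blk (highVal i) ∨
    σ.blk (lowVal i) = σ.blk (highVal i) ∧ σ.star (lowVal i) < σ.star (highVal i)

lemma desc_of_not_asc {σ : BlockState n} {i : Fin (n - 1)} (h : ¬σ.Asc i) :
    σ.blk (highVal i) < σ.blk (lowVal i) ∨
      σ.blk (lowVal i) = σ.blk (highVal i) ∧ σ.star (highVal i) < σ.star (lowVal i) := by
  have hne := σ.star.injective.ne (lowVal_ne_highVal i)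
  unfold Asc at h
  rcases lt_trichotomy (σ.blk (lowVal i)) (σ.blk (highVal i)) with h₁ | h₁ | h₁
  · exact absurd (Or.inl h₁) h
  · rcases lt_or_gt_of_ne hne with h₂ | h₂
    · exact absurd (Or.inr ⟨h₁, h₂⟩) h
    · exact Or.inr ⟨h₁, h₂⟩
  · exact Or.inl h₁

/-- Exchange the rows `i` and `i + 1`. -/
def rowSwap (σ : BlockState n) (i : Fin (n - 1)) : BlockState n :=
  ⟨fun x => σ.blk (adjSwap i x), σ.star * adjSwap i⟩

/-- Simultaneously exchange the rows and the columns `i` and `i + 1`. -/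
def conjSwap (σ : BlockState n) (i : Fin (n - 1)) : BlockState n :=
  ⟨fun x => σ.blk (adjSwap i x), adjSwap i * σ.star * adjSwap i⟩

/-- Exchange rows and columns. -/
def transpose (σ : BlockState n) : BlockState n :=
  ⟨fun x => σ.blk (σ.star⁻¹ x), σ.star⁻¹⟩

/-- The key of `x` lies below the threshold `(β, q)`. -/
def KeyBelow (σ : BlockState n) (β q : ℕ) (x : Fin n) : Prop :=
  σ.blk x < β ∨ σ.blk x = β ∧ (σ.star x : ℕ) < q

instance (σ : BlockState n) (β q : ℕ) : DecidablePred (σ.KeyBelow β q) := fun x =>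
  inferInstanceAs (Decidable (σ.blk x < β ∨ σ.blk x = β ∧ (σ.star x : ℕ) < q))

/-- The rank function of a state. -/
noncomputable def rank (σ : BlockState n) (β p q : ℕ) : ℤ :=
  countBelow (σ.KeyBelow β q) p +
    countBelow (fun y => σ.blk (σ.star⁻¹ y) < β) q

/-- Think of the cells `(x, star x)`. One in a block before `β` counts once for its row being below
`p` and once for its column being below `q`; one in block `β` counts when both hold. This
description is symmetric. -/
lemma rank_transpose (σ : BlockState n) (β p q : ℕ) :
    σ.transpose.rank β q p = σ.rank β p q := by
  classical
  have e₁ := countBelow_comp_equiv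
    (fun x => σ.blk x < β ∨ σ.blk x = β ∧ (x : ℕ) < p) σ.star q
  have e₂ := countBelow_comp_equiv (fun x => σ.blk x < β) σ.star q
  have e₃ : σ.transpose.rank β q p =
      countBelow (fun y => σ.blk (σ.star⁻¹ y) < β ∨
        σ.blk (σ.star⁻¹ y) = β ∧ ((σ.star⁻¹ y : Fin n) : ℕ) < p) q +
      countBelow (fun y => σ.blk y < β) p := by
    have : ∀ y, σ.transpose.blk (σ.transpose.star⁻¹ y) = σ.blk y := by simp [transpose]
    unfold rank
    simp only [this]
    rfl
  rw [e₃, rank, e₁, e₂, countBelow, countBelow, ← Finset.sum_add_distrib, ← Finset.sum_add_distrib]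
  refine Finset.sum_congr rfl fun x _ => ?_
  unfold KeyBelow
  rcases lt_trichotomy (σ.blk x) β with h | h | h
  · simp [h, add_comm]
  · simp [h, and_comm]
  · simp [h.ne', h.not_gt]

lemma Valid.transpose_eq {σ : BlockState n} (h : σ.Valid) : σ.transpose = σ := by
  have e : σ.star⁻¹ = σ.star := by
    rw [inv_eq_iff_mul_eq_one]
    exact Equiv.ext h.star_star
  ext x
  · simp [transpose, e, h.blk_star]
  · simp [transpose, e]

lemma Valid.rank_comm {σ : BlockState n} (h : σ.Valid) (β p q : ℕ) :
    σ.rank β p q = σ.rank β q p := by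
  rw [← rank_transpose, h.transpose_eq]

lemma rank_rowSwap_aux (σ : BlockState n) (i : Fin (n - 1)) (β p q : ℕ) :
    (σ.rowSwap i).rank β p q =
      countBelow (fun x => σ.KeyBelow β q (adjSwap i x)) p +
        countBelow (fun y => σ.blk (σ.star⁻¹ y) < β) q := by
  have : ∀ y, (σ.rowSwap i).blk ((σ.rowSwap i).star⁻¹ y) = σ.blk (σ.star⁻¹ y) := by
    simp [rowSwap]
  unfold rank
  simp only [this]
  rfl

lemma Asc.row_imp {σ : BlockState n} {i : Fin (n - 1)} (h : σ.Asc i) (β q : ℕ) :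
    σ.KeyBelow β q (highVal i) →
      σ.KeyBelow β q (lowVal i) := by
  unfold Asc at h
  rw [Fin.lt_def] at h
  unfold KeyBelow
  omega

lemma desc_row_imp {σ : BlockState n} {i : Fin (n - 1)} (h : ¬σ.Asc i) (β q : ℕ) :
    σ.KeyBelow β q (lowVal i) →
      σ.KeyBelow β q (highVal i) := by
  have h := desc_of_not_asc h
  rw [Fin.lt_def] at h
  unfold KeyBelow
  omega

lemma Asc.rank_rowSwap {σ : BlockState n} {i : Fin (n - 1)} (h : σ.Asc i) (β p q : ℕ) :
    (σ.rowSwap i).rank β p q = raiseAt i (fun p => σ.rank β p q) p := by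
  rw [rank_rowSwap_aux, countBelow_adjSwap_eq_raiseAt (h.row_imp β q), ← raiseAt_add_const]
  rfl

lemma raiseAt_rank_of_not_asc {σ : BlockState n} {i : Fin (n - 1)} (h : ¬σ.Asc i) (β p q : ℕ) :
    raiseAt i (fun p => σ.rank β p q) p = σ.rank β p q := by
  unfold rank
  rw [raiseAt_add_const, raiseAt_countBelow (desc_row_imp h β q)]

lemma rank_rowSwap_of_not_asc {σ : BlockState n} {i : Fin (n - 1)} (h : ¬σ.Asc i) (β p q : ℕ) :
    (σ.rowSwap i).rank β p q = lowerAt i (fun p => σ.rank β p q) p := by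
  rw [rank_rowSwap_aux, countBelow_adjSwap_eq_lowerAt (desc_row_imp h β q), ← lowerAt_add_const]
  rfl

lemma Asc.lowerAt_rank {σ : BlockState n} {i : Fin (n - 1)} (h : σ.Asc i) (β p q : ℕ) :
    lowerAt i (fun p => σ.rank β p q) p = σ.rank β p q := by
  unfold rank
  rw [lowerAt_add_const, lowerAt_countBelow (h.row_imp β q)]

lemma Asc.rank_rowSwap_le {σ : BlockState n} {i : Fin (n - 1)} (h : σ.Asc i) (β p q : ℕ) :
    (σ.rowSwap i).rank β p q ≤ σ.rank β p q := by
  rw [rank_rowSwap_aux, rank]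
  have := countBelow_adjSwap_le (h.row_imp β q) p
  omega

/-- The rank function determines the state. -/
lemma ext_rank {σ τ : BlockState n} (h : ∀ β p q, σ.rank β p q = τ.rank β p q) : σ = τ := by
  classical
  have key : ∀ (x : Fin n) (β q : ℕ), σ.KeyBelow β q x ↔ τ.KeyBelow β q x := by
    intro x β q
    have h₁ := h β (x + 1) q
    have h₂ := h β x q
    unfold rank at h₁ h₂
    rw [countBelow_succ, countBelow_succ] at h₁
    have h₃ : (if σ.KeyBelow β q x then 1 else 0 : ℤ) =
        if τ.KeyBelow β q x then 1 else 0 := by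
      linarith
    split_ifs at h₃ <;> first | omega | (simp only [*])
  unfold KeyBelow at key
  have hb : ∀ x, σ.blk x = τ.blk x := by
    intro x
    have h₁ := key x (σ.blk x + 1) 0
    have h₂ := key x (τ.blk x + 1) 0
    omega
  ext x
  · exact hb x
  · have h₁ := key x (σ.blk x) (σ.star x + 1)
    have h₂ := key x (σ.blk x) (τ.star x + 1)
    have := hb x
    omega

lemma Asc.rowSwap_rank_lt {σ : BlockState n} {i : Fin (n - 1)} (h : σ.Asc i) :
    ∃ β p q, (σ.rowSwap i).rank β p q < σ.rank β p q := by
  by_contra! hcon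
  have : σ.rowSwap i = σ := ext_rank fun β p q => le_antisymm (h.rank_rowSwap_le β p q) (hcon β p q)
  have := congrArg (fun τ => τ.star (lowVal i)) this
  simp only [rowSwap, Perm.mul_apply, adjSwap_lowVal] at this
  exact lowVal_ne_highVal i (σ.star.injective this).symm

/-! ### The two-sided action -/

open Classical in
/-- The action of the `i`-th generator. -/
noncomputable def act (σ : BlockState n) (i : Fin (n - 1)) : BlockState n :=
  if σ.Asc i then
    if σ.star (lowVal i) = lowVal i ∧ σ.star (highVal i) = highVal i ∧
      σ.blk (lowVal i) = σ.blk (highVal i) then σ.rowSwap i else σ.conjSwap i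
  else σ

open Classical in
/-- The downward action of the `i`-th generator. -/
noncomputable def lower (σ : BlockState n) (i : Fin (n - 1)) : BlockState n :=
  if σ.Asc i then σ
  else if σ.star (lowVal i) = highVal i then σ.rowSwap i else σ.conjSwap i

lemma act_of_not_asc {σ : BlockState n} {i : Fin (n - 1)} (h : ¬σ.Asc i) : σ.act i = σ :=
  if_neg h

lemma lower_of_asc {σ : BlockState n} {i : Fin (n - 1)} (h : σ.Asc i) : σ.lower i = σ :=
  if_pos h

lemma star_lt_star_conj {σ : BlockState n} (i : Fin (n - 1))
    (hlt : σ.star (lowVal i) < σ.star (highVal i))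
    (h : ¬(σ.star (lowVal i) = lowVal i ∧ σ.star (highVal i) = highVal i)) :
    adjSwap i (σ.star (lowVal i)) < adjSwap i (σ.star (highVal i)) :=
  adjSwap_lt_adjSwap hlt h

lemma transpose_rowSwap {σ : BlockState n} (hσ : σ.Valid) (i : Fin (n - 1)) :
    (σ.rowSwap i).transpose = ⟨σ.blk, adjSwap i * σ.star⟩ := by
  have e : σ.star⁻¹ = σ.star := by
    rw [inv_eq_iff_mul_eq_one]
    exact Equiv.ext hσ.star_star
  ext x
  · simp [transpose, rowSwap, e, hσ.blk_star]
  · simp [transpose, rowSwap, e]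

/-- Transposing turns the second row swap into a column swap. This is how one-sided rank formulas
give two-sided ones. -/
lemma rowSwap_transpose_rowSwap {σ : BlockState n} (hσ : σ.Valid) (i : Fin (n - 1)) :
    (σ.rowSwap i).transpose.rowSwap i = σ.conjSwap i := by
  rw [transpose_rowSwap hσ]
  rfl

lemma Valid.conjSwap {σ : BlockState n} (hσ : σ.Valid) (i : Fin (n - 1)) :
    (σ.conjSwap i).Valid where
  star_star x := by simp [BlockState.conjSwap, hσ.star_star]
  blk_star x := by simp [BlockState.conjSwap, hσ.blk_star]

lemma conjSwap_conjSwap (σ : BlockState n) (i : Fin (n - 1)) :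
    (σ.conjSwap i).conjSwap i = σ := by
  ext x <;> simp [conjSwap]

lemma rowSwap_rowSwap (σ : BlockState n) (i : Fin (n - 1)) :
    (σ.rowSwap i).rowSwap i = σ := by
  ext x <;> simp [rowSwap]

lemma Valid.rowSwap {σ : BlockState n} (hσ : σ.Valid) {i : Fin (n - 1)}
    (hcomm : ∀ x, σ.star (adjSwap i x) = adjSwap i (σ.star x))
    (hb : σ.blk (lowVal i) = σ.blk (highVal i)) : (σ.rowSwap i).Valid where
  star_star x := by simp [BlockState.rowSwap, hcomm, hσ.star_star]
  blk_star x := by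
    have key : ∀ y, σ.blk (adjSwap i y) = σ.blk y := by
      intro y
      rcases adjSwap_cases i y with ⟨hy, ey⟩ | ⟨hy, ey⟩ | ⟨hy, hy', ey⟩ <;> rw [ey] <;>
        simp [hy, hb]
    simp [BlockState.rowSwap, hσ.blk_star, key]

lemma Valid.comm_of_fixed {σ : BlockState n} {i : Fin (n - 1)}
    (h₀ : σ.star (lowVal i) = lowVal i) (h₁ : σ.star (highVal i) = highVal i) (x : Fin n) :
    σ.star (adjSwap i x) = adjSwap i (σ.star x) := by
  rcases adjSwap_cases i x with ⟨hx, ex⟩ | ⟨hx, ex⟩ | ⟨hx, hx', ex⟩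
  · rw [ex, hx, h₀, h₁, adjSwap_lowVal]
  · rw [ex, hx, h₀, h₁, adjSwap_highVal]
  · rw [ex, adjSwap_of_ne]
    · exact fun e => hx (σ.star.injective (e.trans h₀.symm))
    · exact fun e => hx' (σ.star.injective (e.trans h₁.symm))

lemma Valid.comm_of_exchanged {σ : BlockState n} {i : Fin (n - 1)}
    (h₀ : σ.star (lowVal i) = highVal i) (h₁ : σ.star (highVal i) = lowVal i) (x : Fin n) :
    σ.star (adjSwap i x) = adjSwap i (σ.star x) := by
  rcases adjSwap_cases i x with ⟨hx, ex⟩ | ⟨hx, ex⟩ | ⟨hx, hx', ex⟩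
  · rw [ex, hx, h₀, h₁, adjSwap_highVal]
  · rw [ex, hx, h₀, h₁, adjSwap_lowVal]
  · rw [ex, adjSwap_of_ne]
    · exact fun e => hx' (σ.star.injective (e.trans h₁.symm))
    · exact fun e => hx (σ.star.injective (e.trans h₀.symm))

lemma Valid.star_highVal {σ : BlockState n} (hσ : σ.Valid) {i : Fin (n - 1)}
    (h : σ.star (lowVal i) = highVal i) : σ.star (highVal i) = lowVal i := by
  rw [← h, hσ.star_star]

lemma Valid.act {σ : BlockState n} (hσ : σ.Valid) (i : Fin (n - 1)) : (σ.act i).Valid := by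
  unfold BlockState.act
  split_ifs with h₁ h₂
  · exact hσ.rowSwap (Valid.comm_of_fixed h₂.1 h₂.2.1) h₂.2.2
  · exact hσ.conjSwap i
  · exact hσ

lemma Valid.lower {σ : BlockState n} (hσ : σ.Valid) (i : Fin (n - 1)) : (σ.lower i).Valid := by
  unfold BlockState.lower
  split_ifs with h₁ h₂
  · exact hσ
  · refine hσ.rowSwap (Valid.comm_of_exchanged h₂ (hσ.star_highVal h₂)) ?_
    rw [← h₂, hσ.blk_star]
  · exact hσ.conjSwap i

/-- Two-sided raising of a rank function. -/
def raiseBoth (i : ℕ) (f : ℕ → ℕ → ℤ) (p q : ℕ) : ℤ :=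
  raiseAt i (fun q' => raiseAt i (fun p' => f p' q') p) q

/-- Two-sided lowering of a rank function. -/
def lowerBoth (i : ℕ) (f : ℕ → ℕ → ℤ) (p q : ℕ) : ℤ :=
  lowerAt i (fun q' => lowerAt i (fun p' => f p' q') p) q

/-- On an ascent, raising rows is a row swap. Raising columns is then a second swap, giving the
conjugate, unless `i` and `i+1` are fixed points of one block: there the first swap has created a
descent and the second raising is trivial. Without an ascent both raisings are trivial, by symmetry
of the rank. -/
lemma rank_act {σ : BlockState n} (hσ : σ.Valid) (i : Fin (n - 1)) (β p q : ℕ) :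
    (σ.act i).rank β p q = raiseBoth i (σ.rank β) p q := by
  by_cases h : σ.Asc i
  · have e₁ : ∀ q', raiseAt i (fun p' => σ.rank β p' q') p =
        (σ.rowSwap i).transpose.rank β q' p := fun q' => by
      rw [rank_transpose, h.rank_rowSwap]
    unfold raiseBoth
    simp only [e₁]
    rw [act, if_pos h]
    split_ifs with h₂
    · rw [raiseAt_rank_of_not_asc, rank_transpose]
      rw [transpose_rowSwap hσ]
      simp [Asc, h₂.1, h₂.2.1, h₂.2.2, (lowVal_lt_highVal i).le]
    · rw [← Asc.rank_rowSwap, rowSwap_transpose_rowSwap hσ, (hσ.conjSwap i).rank_comm]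
      rw [transpose_rowSwap hσ]
      rcases h with h | ⟨h, h'⟩
      · exact Or.inl h
      · exact Or.inr ⟨h, star_lt_star_conj i h' fun e => h₂ ⟨e.1, e.2, h⟩⟩
  · unfold raiseBoth
    simp only [raiseAt_rank_of_not_asc h, act_of_not_asc h]
    simp only [hσ.rank_comm β p]
    rw [raiseAt_rank_of_not_asc h]

lemma rank_lower {σ : BlockState n} (hσ : σ.Valid) (i : Fin (n - 1)) (β p q : ℕ) :
    (σ.lower i).rank β p q = lowerBoth i (σ.rank β) p q := by
  by_cases h : σ.Asc i
  · unfold lowerBoth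
    simp only [h.lowerAt_rank, lower_of_asc h]
    simp only [hσ.rank_comm β p]
    rw [h.lowerAt_rank]
  · have e₁ : ∀ q', lowerAt i (fun p' => σ.rank β p' q') p =
        (σ.rowSwap i).transpose.rank β q' p := fun q' => by
      rw [rank_transpose, rank_rowSwap_of_not_asc h]
    unfold lowerBoth
    simp only [e₁]
    rw [lower, if_neg h]
    split_ifs with h₂
    · rw [Asc.lowerAt_rank, rank_transpose]
      rw [transpose_rowSwap hσ]
      refine Or.inr ⟨?_, ?_⟩
      · show σ.blk _ = σ.blk _
        rw [← h₂, hσ.blk_star]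
      · simp [h₂, hσ.star_highVal h₂, lowVal_lt_highVal]
    · rw [← rank_rowSwap_of_not_asc, rowSwap_transpose_rowSwap hσ, (hσ.conjSwap i).rank_comm]
      rw [transpose_rowSwap hσ]
      rcases desc_of_not_asc h with h | ⟨h, h'⟩
      · rintro (h₃ | ⟨h₃, -⟩)
        · exact lt_asymm h h₃
        · exact h.ne' h₃
      · rintro (h₃ | ⟨-, h₃⟩)
        · exact h₃.ne h
        · refine lt_asymm h₃ (adjSwap_lt_adjSwap h' fun e => h₂ e.2)

/-- With `act_lower_of_not_asc`: `act i` and `lower i` are inverse bijections between valid states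
ascending at `i` and those not ascending at `i`. -/
lemma Asc.lower_act {σ : BlockState n} (hσ : σ.Valid) {i : Fin (n - 1)} (h : σ.Asc i) :
    ¬(σ.act i).Asc i ∧ (σ.act i).lower i = σ := by
  rw [act, if_pos h]
  split_ifs with h₂
  · have h₃ : ¬(σ.rowSwap i).Asc i := by
      simp [Asc, rowSwap, h₂.1, h₂.2.1, h₂.2.2, (lowVal_lt_highVal i).le]
    refine ⟨h₃, ?_⟩
    rw [lower, if_neg h₃, if_pos (by simp [rowSwap, h₂.2.1]), rowSwap_rowSwap]
  · have h₃ : ¬(σ.conjSwap i).Asc i := by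
      rcases h with h | ⟨h, h'⟩
      · rintro (h₃ | ⟨h₃, -⟩) <;> simp [conjSwap] at h₃ <;> omega
      · rintro (h₃ | ⟨-, h₃⟩)
        · simp [conjSwap] at h₃; omega
        · refine lt_asymm ?_ h₃
          simpa [conjSwap] using star_lt_star_conj i h' fun e => h₂ ⟨e.1, e.2, h⟩
    refine ⟨h₃, ?_⟩
    rw [lower, if_neg h₃, if_neg, conjSwap_conjSwap]
    intro e
    have e₁ : σ.star (highVal i) = lowVal i := by
      apply (adjSwap i).injective
      simpa [conjSwap] using e
    have e₂ : σ.star (lowVal i) = highVal i := by rw [← e₁, hσ.star_star]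
    have e₃ : σ.blk (highVal i) = σ.blk (lowVal i) := by rw [← e₂, hσ.blk_star]
    rcases h with h | ⟨-, h⟩
    · exact h.ne' e₃
    · rw [e₁, e₂] at h
      exact lt_asymm h (lowVal_lt_highVal i)

lemma act_lower_of_not_asc {σ : BlockState n} (hσ : σ.Valid) {i : Fin (n - 1)} (h : ¬σ.Asc i) :
    (σ.lower i).Asc i ∧ (σ.lower i).act i = σ := by
  rw [lower, if_neg h]
  split_ifs with h₂
  · have h₁ := hσ.star_highVal h₂
    have hb : σ.blk (lowVal i) = σ.blk (highVal i) := by rw [← h₂, hσ.blk_star]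
    have h₃ : (σ.rowSwap i).Asc i := by
      simp [Asc, rowSwap, h₁, h₂, hb, lowVal_lt_highVal]
    refine ⟨h₃, ?_⟩
    rw [act, if_pos h₃, if_pos (by simp [rowSwap, h₁, h₂, hb]), rowSwap_rowSwap]
  · have hd := desc_of_not_asc h
    have h₃ : (σ.conjSwap i).Asc i := by
      rcases hd with h | ⟨h, h'⟩
      · left; simpa [conjSwap] using h
      · right
        refine ⟨by simp [conjSwap, h], ?_⟩
        simpa [conjSwap] using adjSwap_lt_adjSwap h' fun e => h₂ e.2
    refine ⟨h₃, ?_⟩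
    rw [act, if_pos h₃, if_neg, conjSwap_conjSwap]
    rintro ⟨e₀, e₁, e₂⟩
    have e₀' : σ.star (highVal i) = highVal i := by
      apply (adjSwap i).injective
      simpa [conjSwap] using e₀
    have e₁' : σ.star (lowVal i) = lowVal i := by
      apply (adjSwap i).injective
      simpa [conjSwap] using e₁
    have e₂' : σ.blk (highVal i) = σ.blk (lowVal i) := by simpa [conjSwap] using e₂
    rcases hd with h | ⟨-, h⟩
    · exact h.ne e₂'
    · rw [e₀', e₁'] at h
      exact lt_asymm h (lowVal_lt_highVal i)

end BlockState

/-! ## Strict words and the order defined by the rank functions -/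

section
variable {n : ℕ}

lemma forall_of_countBelow_le {κ κ' : Fin n → Prop} {p : ℕ} (hκ : ∀ y : Fin n, (y : ℕ) < p → κ y)
    (h : countBelow κ p ≤ countBelow κ' p) (y : Fin n) (hy : (y : ℕ) < p) : κ' y := by
  classical
  by_contra hcon
  refine absurd h (not_le.2 ?_)
  refine Finset.sum_lt_sum (fun x _ => ?_) ⟨y, Finset.mem_univ y, ?_⟩
  · by_cases hx : (x : ℕ) < p
    · simp only [hx, hκ x hx, and_self, if_true]
      split_ifs <;> omega
    · simp [hx]
  · simp [hy, hκ y hy, hcon]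

@[simp] lemma countBelow_zero (κ : Fin n → Prop) : countBelow κ 0 = 0 := by
  simp [countBelow]

end

namespace BlockState
variable {n : ℕ}

/-- The inequality of ranks is reversed because ascents decrease ranks. -/
instance : LE (BlockState n) := ⟨fun σ τ => ∀ β p q, τ.rank β p q ≤ σ.rank β p q⟩

instance : PartialOrder (BlockState n) where
  le_refl _ := fun _ _ _ => le_rfl
  le_trans _ _ _ h₁ h₂ := fun β p q => (h₂ β p q).trans (h₁ β p q)
  le_antisymm _ _ h₁ h₂ := ext_rank fun β p q => le_antisymm (h₂ β p q) (h₁ β p q)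

/-- The new rank is the same monotone function of the old rank for both states. -/
lemma act_le_act {σ τ : BlockState n} (hσ : σ.Valid) (hτ : τ.Valid) (h : σ ≤ τ)
    (i : Fin (n - 1)) : σ.act i ≤ τ.act i := by
  intro β p q
  rw [rank_act hσ, rank_act hτ]
  exact raiseAt_mono (fun q' => raiseAt_mono (fun p' => h β p' q') p) q

lemma lower_le_lower {σ τ : BlockState n} (hσ : σ.Valid) (hτ : τ.Valid) (h : σ ≤ τ)
    (i : Fin (n - 1)) : σ.lower i ≤ τ.lower i := by
  intro β p q
  rw [rank_lower hσ, rank_lower hτ]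
  exact lowerAt_mono (fun q' => lowerAt_mono (fun p' => h β p' q') p) q

lemma Asc.conjSwap_le {σ : BlockState n} (hσ : σ.Valid) {i : Fin (n - 1)} (h : σ.Asc i)
    (h₂ : ¬(σ.star (lowVal i) = lowVal i ∧ σ.star (highVal i) = highVal i ∧
      σ.blk (lowVal i) = σ.blk (highVal i))) (β p q : ℕ) :
    (σ.conjSwap i).rank β p q ≤ (σ.rowSwap i).rank β p q := by
  rw [(hσ.conjSwap i).rank_comm, ← rowSwap_transpose_rowSwap hσ, ← rank_transpose (σ.rowSwap i)]
  apply Asc.rank_rowSwap_le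
  rw [transpose_rowSwap hσ]
  rcases h with h | ⟨h, h'⟩
  · exact Or.inl h
  · exact Or.inr ⟨h, star_lt_star_conj i h' fun e => h₂ ⟨e.1, e.2, h⟩⟩

lemma Asc.lt_act {σ : BlockState n} (hσ : σ.Valid) {i : Fin (n - 1)} (h : σ.Asc i) :
    σ < σ.act i := by
  have key : ∀ β p q, (σ.act i).rank β p q ≤ (σ.rowSwap i).rank β p q := by
    intro β p q
    rw [act, if_pos h]
    split_ifs with h₂
    · exact le_rfl
    · exact h.conjSwap_le hσ h₂ β p q
  refine lt_of_le_of_ne (fun β p q => (key β p q).trans (h.rank_rowSwap_le β p q)) fun e => ?_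
  obtain ⟨β, p, q, hlt⟩ := h.rowSwap_rank_lt
  have := key β p q
  rw [← e] at this
  omega

lemma le_act {σ : BlockState n} (hσ : σ.Valid) (i : Fin (n - 1)) : σ ≤ σ.act i := by
  by_cases h : σ.Asc i
  · exact (h.lt_act hσ).le
  · rw [act_of_not_asc h]

/-- The block sizes are those of `b₀`. -/
def Rearranges (σ : BlockState n) (b₀ : Fin n → ℕ) : Prop :=
  ∃ g : Perm (Fin n), ∀ x, σ.blk x = b₀ (g x)

lemma Rearranges.comp {σ τ : BlockState n} {b₀ : Fin n → ℕ} (h : σ.Rearranges b₀)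
    (g : Perm (Fin n)) (hτ : ∀ x, τ.blk x = σ.blk (g x)) : τ.Rearranges b₀ := by
  obtain ⟨g', hg'⟩ := h
  exact ⟨g' * g, fun x => by rw [hτ, hg', Perm.mul_apply]⟩

lemma Rearranges.lower {σ : BlockState n} {b₀ : Fin n → ℕ} (h : σ.Rearranges b₀)
    (i : Fin (n - 1)) : (σ.lower i).Rearranges b₀ := by
  unfold BlockState.lower
  split_ifs
  · exact h
  · exact h.comp (adjSwap i) fun _ => rfl
  · exact h.comp (adjSwap i) fun _ => rfl

/-- The state with blocks `b₀` and trivial involution. -/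
def base (b₀ : Fin n → ℕ) : BlockState n := ⟨b₀, 1⟩

lemma base_valid (b₀ : Fin n → ℕ) : (base b₀).Valid := ⟨fun _ => rfl, fun _ => rfl⟩

/-- Thresholds at which the base count is full force the count of `σ` to be full. With `q = 0` this
gives `blk x ≤ b₀ x`, and equality since both sides have the same sum; with `p = q = x + 1` it gives
`star x ≤ x`, and an involution with this property is trivial. -/
lemma eq_base_of_le {b₀ : Fin n → ℕ} (hb : Monotone b₀) {σ : BlockState n} (hσ : σ.Valid)
    (hr : σ.Rearranges b₀) (h : σ ≤ base b₀) : σ = base b₀ := by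
  have hle : ∀ x, σ.blk x ≤ b₀ x := by
    intro x
    have h₁ := h (b₀ x + 1) (x + 1) 0
    simp only [rank, countBelow_zero, add_zero] at h₁
    have := forall_of_countBelow_le (fun y hy => Or.inl ?_) h₁ x (by omega)
    · unfold KeyBelow at this
      omega
    · exact Nat.lt_succ_of_le (hb (Fin.le_def.2 (by omega)))
  have hblk : ∀ x, σ.blk x = b₀ x := by
    obtain ⟨g, hg⟩ := hr
    have hsum : ∑ x, σ.blk x = ∑ x, b₀ x := by
      simp only [hg]
      exact Equiv.sum_comp g b₀
    intro x
    exact (Finset.sum_eq_sum_iff_of_le fun x _ => hle x).1 hsum x (Finset.mem_univ x)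
  have hstar : ∀ x, σ.star x ≤ x := by
    intro x
    have h₁ := h (b₀ x) (x + 1) (x + 1)
    have h₂ : ∀ y, σ.blk (σ.star⁻¹ y) = b₀ y := fun y => by
      rw [← hblk y, ← hσ.blk_star (σ.star⁻¹ y), Perm.coe_inv, Equiv.apply_symm_apply]
    have h₃ : ∀ y, (base b₀).blk ((base b₀).star⁻¹ y) = b₀ y := fun y => rfl
    simp only [rank, h₂, h₃, add_le_add_iff_right] at h₁
    have := forall_of_countBelow_le (fun y hy => ?_) h₁ x (by omega)
    · unfold KeyBelow at this
      rw [hblk, Fin.le_def] at *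
      omega
    · have := hb (show y ≤ x from Fin.le_def.2 (by omega))
      unfold KeyBelow
      simp only [base, Perm.one_apply]
      omega
  ext x
  · exact hblk x
  · have h₁ := hstar (σ.star x)
    rw [hσ.star_star] at h₁
    exact congrArg _ (le_antisymm (hstar x) h₁)

/-- The state reached from the base state by a word. -/
noncomputable def run (b₀ : Fin n → ℕ) (a : List (Fin (n - 1))) : BlockState n :=
  a.foldl act (base b₀)

lemma run_append_singleton (b₀ : Fin n → ℕ) (a : List (Fin (n - 1))) (i : Fin (n - 1)) :
    run b₀ (a ++ [i]) = (run b₀ a).act i := by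
  simp [run]

lemma run_valid (b₀ : Fin n → ℕ) (a : List (Fin (n - 1))) : (run b₀ a).Valid := by
  induction a using List.reverseRecOn with
  | nil => exact base_valid b₀
  | append_singleton a i ih => rw [run_append_singleton]; exact ih.act i

/-- Words all of whose letters act by an ascent. -/
inductive Strict (b₀ : Fin n → ℕ) : List (Fin (n - 1)) → BlockState n → Prop
  | nil : Strict b₀ [] (base b₀)
  | snoc {a : List (Fin (n - 1))} {σ : BlockState n} {i : Fin (n - 1)} :
      Strict b₀ a σ → σ.Asc i → Strict b₀ (a ++ [i]) (σ.act i)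

variable {b₀ : Fin n → ℕ}

lemma Strict.run_eq {a : List (Fin (n - 1))} {σ : BlockState n} (h : Strict b₀ a σ) :
    run b₀ a = σ := by
  induction h with
  | nil => rfl
  | snoc _ _ ih => rw [run_append_singleton, ih]

lemma Strict.valid {a : List (Fin (n - 1))} {σ : BlockState n} (h : Strict b₀ a σ) : σ.Valid :=
  h.run_eq ▸ run_valid b₀ a

lemma exists_strict_sublist (b₀ : Fin n → ℕ) (a : List (Fin (n - 1))) :
    ∃ b, b.Sublist a ∧ Strict b₀ b (run b₀ a) := by
  induction a using List.reverseRecOn with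
  | nil => exact ⟨[], List.Sublist.refl _, .nil⟩
  | append_singleton a i ih =>
    obtain ⟨b, hb, hs⟩ := ih
    rw [run_append_singleton]
    by_cases h : (run b₀ a).Asc i
    · exact ⟨b ++ [i], hb.append (List.Sublist.refl _), hs.snoc h⟩
    · rw [act_of_not_asc h]
      exact ⟨b, hb.trans (List.sublist_append_left _ _), hs⟩

/-- Subword property, from the order to subwords. -/
lemma Strict.exists_sublist (hb : Monotone b₀) {a : List (Fin (n - 1))} {τ : BlockState n}
    (ha : Strict b₀ a τ) {σ : BlockState n} (hσ : σ.Valid) (hr : σ.Rearranges b₀) (h : σ ≤ τ) :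
    ∃ b, b.Sublist a ∧ Strict b₀ b σ := by
  induction ha generalizing σ with
  | nil =>
    rw [eq_base_of_le hb hσ hr h]
    exact ⟨[], List.Sublist.refl _, .nil⟩
  | @snoc a τ i ha hasc ih =>
    have hτ := ha.valid
    -- Lifting property: lowering at `i` preserves the inequality and takes `τ.act i` back to `τ`.
    have hl := lower_le_lower hσ (hτ.act i) h i
    rw [(hasc.lower_act hτ).2] at hl
    obtain ⟨b, hb', hs⟩ := ih (hσ.lower i) (hr.lower i) hl
    by_cases hd : σ.Asc i
    · rw [lower_of_asc hd] at hs
      exact ⟨b, hb'.trans (List.sublist_append_left _ _), hs⟩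
    · obtain ⟨h₁, h₂⟩ := act_lower_of_not_asc hσ hd
      refine ⟨b ++ [i], hb'.append (List.Sublist.refl _), ?_⟩
      rw [← h₂]
      exact hs.snoc h₁

/-- Subword property, from subwords to the order. -/
lemma run_le_run_of_sublist {a b : List (Fin (n - 1))} (h : b.Sublist a) :
    run b₀ b ≤ run b₀ a := by
  induction a using List.reverseRecOn generalizing b with
  | nil => rw [List.sublist_nil.1 h]
  | append_singleton a i ih =>
    rw [run_append_singleton]
    obtain ⟨b₁, b₂, rfl, h₁, h₂⟩ := List.sublist_append_iff.1 h
    rcases List.sublist_singleton.1 h₂ with rfl | rfl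
    · rw [List.append_nil]
      exact (ih h₁).trans (le_act (run_valid _ _) i)
    · rw [run_append_singleton]
      exact act_le_act (run_valid _ _) (run_valid _ _) (ih h₁) i

lemma run_rearranges (b₀ : Fin n → ℕ) (a : List (Fin (n - 1))) :
    (run b₀ a).Rearranges b₀ := by
  induction a using List.reverseRecOn with
  | nil => exact ⟨1, fun _ => rfl⟩
  | append_singleton a i ih =>
    rw [run_append_singleton]
    unfold act
    split_ifs
    · exact ih.comp (adjSwap i) fun _ => rfl
    · exact ih.comp (adjSwap i) fun _ => rfl
    · exact ih

lemma Strict.rearranges {a : List (Fin (n - 1))} {σ : BlockState n} (h : Strict b₀ a σ) :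
    σ.Rearranges b₀ :=
  h.run_eq ▸ run_rearranges b₀ a

/-- The state before the last letter of `a` lies strictly below `τ`, so it has a strict word that is
a proper subword of `b`; induction compares the rest. -/
lemma Strict.length_le (hb : Monotone b₀) {a : List (Fin (n - 1))} {τ : BlockState n}
    (ha : Strict b₀ a τ) {b : List (Fin (n - 1))} (hs : Strict b₀ b τ) :
    a.length ≤ b.length := by
  induction ha generalizing b with
  | nil => simp
  | @snoc a τ i ha hasc ih =>
    have hlt := hasc.lt_act ha.valid
    obtain ⟨c, hc, hcs⟩ := hs.exists_sublist hb ha.valid ha.rearranges hlt.le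
    have h₁ := ih hcs
    have h₂ : c.length ≠ b.length := fun e => by
      rw [hc.eq_of_length e] at hcs
      exact hlt.ne (hcs.run_eq.symm.trans hs.run_eq)
    have h₃ := hc.length_le
    simp only [List.length_append, List.length_singleton]
    omega

lemma Strict.length_eq (hb : Monotone b₀) {a b : List (Fin (n - 1))} {τ : BlockState n}
    (ha : Strict b₀ a τ) (hs : Strict b₀ b τ) : a.length = b.length :=
  le_antisymm (ha.length_le hb hs) (hs.length_le hb ha)

lemma strict_iff (hb : Monotone b₀) {a : List (Fin (n - 1))} {τ : BlockState n} :
    Strict b₀ a τ ↔ run b₀ a = τ ∧ ∀ b, run b₀ b = τ → a.length ≤ b.length := by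
  constructor
  · refine fun h => ⟨h.run_eq, fun b e => ?_⟩
    obtain ⟨c, hc, hs⟩ := exists_strict_sublist b₀ b
    rw [e] at hs
    exact (h.length_le hb hs).trans hc.length_le
  · rintro ⟨rfl, hmin⟩
    obtain ⟨c, hc, hs⟩ := exists_strict_sublist b₀ a
    rwa [hc.eq_of_length (le_antisymm hc.length_le (hmin c hs.run_eq))] at hs

/-- Below any strictly larger state there is one of corank one. -/
lemma Strict.exists_corank_one {a : List (Fin (n - 1))} {τ : BlockState n}
    (ha : Strict b₀ a τ) {σ : BlockState n} (hb : Monotone b₀) (hσ : σ.Valid)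
    (hr : σ.Rearranges b₀) (h : σ < τ) :
    ∃ ρ c, Strict b₀ c ρ ∧ c.length + 1 = a.length ∧ σ ≤ ρ ∧ ρ ≤ τ := by
  induction ha generalizing σ with
  | nil => exact absurd (eq_base_of_le hb hσ hr h.le) h.ne
  | @snoc a τ i ha hasc ih =>
    have hτ := ha.valid
    have hl := lower_le_lower hσ (hτ.act i) h.le i
    rw [(hasc.lower_act hτ).2] at hl
    have hττ := le_act hτ i
    by_cases hd : σ.Asc i
    · rw [lower_of_asc hd] at hl
      exact ⟨τ, a, ha, by simp, hl, hττ⟩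
    · obtain ⟨h₁, h₂⟩ := act_lower_of_not_asc hσ hd
      have hlt : σ.lower i < τ := by
        refine lt_of_le_of_ne hl fun e => h.ne ?_
        rw [← e, h₂]
      obtain ⟨ρ, c, hc, hlen, h₃, h₄⟩ := ih (hσ.lower i) (hr.lower i) hlt
      have h₅ := act_le_act (hσ.lower i) hc.valid h₃ i
      rw [h₂] at h₅
      -- If `ρ` has no ascent at `i`, then `σ ≤ ρ ≤ τ` already, and `τ` itself has corank one below
      -- `τ.act i`.
      by_cases hρ : ρ.Asc i
      · refine ⟨ρ.act i, c ++ [i], hc.snoc hρ, by simp [hlen], h₅, ?_⟩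
        exact act_le_act hc.valid hτ h₄ i
      · rw [act_of_not_asc hρ] at h₅
        exact ⟨τ, a, ha, by simp, h₅.trans h₄, hττ⟩

end BlockState

/-! ## The rank function of the state reached by a permutation -/

namespace BlockState
variable {n : ℕ}

/-- The number of `x < p` with `w x < k`. -/
noncomputable def permCount (w : Perm (Fin n)) (p k : ℕ) : ℤ :=
  countBelow (fun x => (w x : ℕ) < k) p

open Classical in
/-- The right `0`-Hecke product with a generator. -/
noncomputable def heckeMul (w : Perm (Fin n)) (i : Fin (n - 1)) : Perm (Fin n) :=
  if w (lowVal i) < w (highVal i) then w * adjSwap i else w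

lemma permCount_heckeMul (w : Perm (Fin n)) (i : Fin (n - 1)) (p k : ℕ) :
    permCount (heckeMul w i) p k = raiseAt i (fun p => permCount w p k) p := by
  unfold heckeMul permCount
  split_ifs with h
  · rw [Fin.lt_def] at h
    exact countBelow_adjSwap_eq_raiseAt (κ := fun x => (w x : ℕ) < k) (fun h' => h.trans h') p
  · have h := lt_of_le_of_ne (not_lt.1 h) (w.injective.ne (lowVal_ne_highVal i).symm)
    rw [Fin.lt_def] at h
    exact (raiseAt_countBelow (κ := fun x => (w x : ℕ) < k) (fun h' => h.trans h') p).symm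

/-- The rank function of `σ` is the max-plus square of the counts of `w`, taken block by block;
`m β` is the number of positions before the block `β`. -/
structure MaxForm (m : ℕ → ℕ) (w : Perm (Fin n)) (σ : BlockState n) : Prop where
  upper : ∀ β p q k, m β ≤ k → k ≤ m (β + 1) →
    m β + permCount w p k + permCount w q k - k ≤ σ.rank β p q
  attained : ∀ β p q, ∃ k, m β ≤ k ∧ k ≤ m (β + 1) ∧
    σ.rank β p q = m β + permCount w p k + permCount w q k - k

/-- A permutation therefore determines the state it leads to. -/
lemma MaxForm.eq {m : ℕ → ℕ} {w : Perm (Fin n)} {σ τ : BlockState n} (h : MaxForm m w σ)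
    (h' : MaxForm m w τ) : σ = τ := by
  refine ext_rank fun β p q => le_antisymm ?_ ?_
  · obtain ⟨k, h₁, h₂, e⟩ := h.attained β p q
    rw [e]
    exact h'.upper β p q k h₁ h₂
  · obtain ⟨k, h₁, h₂, e⟩ := h'.attained β p q
    rw [e]
    exact h.upper β p q k h₁ h₂

/-- `raiseAt` is a maximum of two shifts by constants, so it commutes with the maximum over `k`; for
a fixed `k`, the raising in `p` and the raising in `q` act on separate summands. -/
lemma MaxForm.act {m : ℕ → ℕ} {w : Perm (Fin n)} {σ : BlockState n} (h : MaxForm m w σ)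
    (hσ : σ.Valid) (i : Fin (n - 1)) : MaxForm m (heckeMul w i) (σ.act i) := by
  have hup : ∀ β p q k, m β ≤ k → k ≤ m (β + 1) →
      m β + permCount (heckeMul w i) p k + permCount (heckeMul w i) q k - k ≤
        (σ.act i).rank β p q := by
    intro β p q k h₁ h₂
    have H : ∀ p q, _ := fun p q => h.upper β p q k h₁ h₂
    rw [rank_act hσ, permCount_heckeMul, permCount_heckeMul]
    simp only [raiseBoth, raiseAt]
    have := H p q
    have := H i q
    have := H (i + 2) q
    have := H p i
    have := H p (i + 2)
    have := H i i
    have := H i (i + 2)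
    have := H (i + 2) i
    have := H (i + 2) (i + 2)
    split_ifs <;> omega
  refine ⟨hup, fun β p q => ?_⟩
  suffices ∃ k, m β ≤ k ∧ k ≤ m (β + 1) ∧ (σ.act i).rank β p q ≤
      m β + permCount (heckeMul w i) p k + permCount (heckeMul w i) q k - k by
    obtain ⟨k, h₁, h₂, h₃⟩ := this
    exact ⟨k, h₁, h₂, le_antisymm h₃ (hup β p q k h₁ h₂)⟩
  rw [rank_act hσ]
  simp only [permCount_heckeMul, raiseBoth, raiseAt]
  have H : ∀ p q, _ := fun p q => h.attained β p q
  split_ifs with hq hp hp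
  · obtain ⟨k₁, l₁, u₁, e₁⟩ := H i i
    obtain ⟨k₂, l₂, u₂, e₂⟩ := H i (i + 2)
    obtain ⟨k₃, l₃, u₃, e₃⟩ := H (i + 2) i
    obtain ⟨k₄, l₄, u₄, e₄⟩ := H (i + 2) (i + 2)
    rcases max_choice (max (σ.rank β i i) (σ.rank β (i + 2) i - 1))
      (max (σ.rank β i (i + 2)) (σ.rank β (i + 2) (i + 2) - 1) - 1) with h | h <;> rw [h]
    · rcases max_choice (σ.rank β i i) (σ.rank β (i + 2) i - 1) with h | h <;> rw [h]
      · exact ⟨k₁, l₁, u₁, by omega⟩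
      · exact ⟨k₃, l₃, u₃, by omega⟩
    · rcases max_choice (σ.rank β i (i + 2)) (σ.rank β (i + 2) (i + 2) - 1) with h | h <;> rw [h]
      · exact ⟨k₂, l₂, u₂, by omega⟩
      · exact ⟨k₄, l₄, u₄, by omega⟩
  · obtain ⟨k₁, l₁, u₁, e₁⟩ := H p i
    obtain ⟨k₂, l₂, u₂, e₂⟩ := H p (i + 2)
    rcases max_choice (σ.rank β p i) (σ.rank β p (i + 2) - 1) with h | h <;> rw [h]
    · exact ⟨k₁, l₁, u₁, by omega⟩
    · exact ⟨k₂, l₂, u₂, by omega⟩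
  · obtain ⟨k₁, l₁, u₁, e₁⟩ := H i q
    obtain ⟨k₂, l₂, u₂, e₂⟩ := H (i + 2) q
    rcases max_choice (σ.rank β i q) (σ.rank β (i + 2) q - 1) with h | h <;> rw [h]
    · exact ⟨k₁, l₁, u₁, by omega⟩
    · exact ⟨k₂, l₂, u₂, by omega⟩
  · obtain ⟨k₁, l₁, u₁, e₁⟩ := H p q
    exact ⟨k₁, l₁, u₁, by omega⟩

/-- `b₀ x` is the index of the block containing the position `x`, where the blocks are cut at the
positions `m β`. -/
structure Cuts (m : ℕ → ℕ) (b₀ : Fin n → ℕ) : Prop where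
  lt_iff : ∀ (x : Fin n) (β : ℕ), b₀ x < β ↔ (x : ℕ) < m β
  mono : Monotone m
  le : ∀ β, m β ≤ n

lemma Cuts.monotone {m : ℕ → ℕ} {b₀ : Fin n → ℕ} (h : Cuts m b₀) : Monotone b₀ := by
  intro x y hxy
  have h₁ := (h.lt_iff y (b₀ y + 1)).1 (Nat.lt_succ_self _)
  have := (h.lt_iff x (b₀ y + 1)).2 (lt_of_le_of_lt (Fin.le_def.1 hxy) h₁)
  omega

lemma countBelow_val_lt {k p : ℕ} (h : min p k ≤ n) :
    countBelow (fun x : Fin n => (x : ℕ) < k) p = (min p k : ℕ) := by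
  classical
  unfold countBelow
  simp only [← lt_min_iff]
  rw [Finset.sum_boole]
  congr 1
  have : (Finset.univ.filter fun x : Fin n => (x : ℕ) < min p k) =
      Finset.univ.map (Fin.castLEEmb h) := by
    ext x
    simp only [Finset.mem_filter, Finset.mem_univ, true_and, Finset.mem_map]
    constructor
    · exact fun hx => ⟨⟨x, hx⟩, rfl⟩
    · rintro ⟨y, rfl⟩
      exact y.isLt
  rw [this, Finset.card_map, Finset.card_univ, Fintype.card_fin]

lemma maxForm_base {m : ℕ → ℕ} {b₀ : Fin n → ℕ} (h : Cuts m b₀) :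
    MaxForm m 1 (base b₀) := by
  have hr : ∀ β p q, (base b₀).rank β p q =
      (min p (max (m β) (min (m (β + 1)) q)) : ℕ) + (min q (m β) : ℕ) := by
    intro β p q
    have h₁ := h.le β
    have h₂ := h.le (β + 1)
    rw [← countBelow_val_lt (n := n) (by omega), ← countBelow_val_lt (n := n) (by omega)]
    unfold rank
    congr 2
    · funext x
      have h₃ := h.lt_iff x β
      have h₄ := h.lt_iff x (β + 1)
      simp only [KeyBelow, base, Perm.one_apply, eq_iff_iff]
      omega
    · funext x
      exact propext (h.lt_iff x β)
  have hw : ∀ β p k, k ≤ m β → permCount (1 : Perm (Fin n)) p k = (min p k : ℕ) := by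
    intro β p k hk
    have := h.le β
    exact countBelow_val_lt (by omega)
  constructor
  · intro β p q k h₁ h₂
    rw [hr, hw (β + 1) p k h₂, hw (β + 1) q k h₂]
    omega
  · intro β p q
    have := h.mono (show β ≤ β + 1 by omega)
    -- As a function of `k` the value rises up to `min p q`, stays constant up to `max p q` and then
    -- falls; the witness is `min p q` clamped to the block.
    refine ⟨max (m β) (min (m (β + 1)) (min p q)), by omega, by omega, ?_⟩
    rw [hr, hw (β + 1) _ _ (by omega), hw (β + 1) _ _ (by omega)]
    omega

/-- The state reached by a reduced word depends only on its product. -/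
lemma maxForm_of_reduced {m : ℕ → ℕ} {b₀ : Fin n → ℕ} (h : Cuts m b₀)
    (a : List (Fin (n - 1))) (ha : invCount (wordProd a) = a.length) :
    MaxForm m (wordProd a) (run b₀ a) := by
  induction a using List.reverseRecOn with
  | nil => exact maxForm_base h
  | append_singleton a i ih =>
    rw [wordProd_append_singleton, List.length_append, List.length_singleton] at ha
    have hle := invCount_wordProd_le a
    -- A descent at the last letter would leave too few inversions for a reduced word.
    have hlt : wordProd a (lowVal i) < wordProd a (highVal i) := by
      by_contra hcon
      have := invCount_mul_adjSwap_of_gt (lt_of_le_of_ne (not_lt.1 hcon)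
        ((wordProd a).injective.ne (lowVal_ne_highVal i).symm))
      omega
    have hinv := invCount_mul_adjSwap hlt
    have := (ih (by omega)).act (run_valid b₀ a) i
    rwa [heckeMul, if_pos hlt, ← wordProd_append_singleton, ← run_append_singleton] at this

/-! ## Atoms -/

/-- Necessary conditions for `w` to be an atom of the state `σ`. -/
structure IsAtom (b₀ : Fin n → ℕ) (w : Perm (Fin n)) (σ : BlockState n) : Prop where
  blk_eq : ∀ x, σ.blk x = b₀ (w x)
  desc : ∀ a, a < σ.star a → w (σ.star a) < w a
  not_between : ∀ a e, a < e → e < σ.star a → σ.blk e = σ.blk a →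
    ¬(w (σ.star a) < w e ∧ w e < w a)
  cross : ∀ a c, σ.blk a = σ.blk c → a ≤ σ.star a → c ≤ σ.star c → a < c →
    σ.star a < σ.star c → w a < w (σ.star c)

lemma isAtom_base (b₀ : Fin n → ℕ) : IsAtom b₀ 1 (base b₀) where
  blk_eq _ := rfl
  desc a h := absurd h (lt_irrefl a)
  not_between _ _ h h' := absurd (h.trans h') (lt_irrefl _)
  cross _ _ _ _ _ h _ := h

lemma lt_or_of_lt (i : Fin (n - 1)) {x y : Fin n} (h : x < y) :
    adjSwap i x < adjSwap i y ∨ x = lowVal i ∧ y = highVal i := by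
  by_cases h' : x = lowVal i ∧ y = highVal i
  · exact Or.inr h'
  · exact Or.inl (adjSwap_lt_adjSwap h h')

lemma Asc.star_ne {σ : BlockState n} (hσ : σ.Valid) {i : Fin (n - 1)} (h : σ.Asc i) :
    σ.star (highVal i) ≠ lowVal i := by
  intro e
  have e' : σ.star (lowVal i) = highVal i := by rw [← e, hσ.star_star]
  rcases h with h | ⟨-, h⟩
  · rw [← e, hσ.blk_star] at h
    exact lt_irrefl _ h
  · rw [e, e'] at h
    exact lt_asymm h (lowVal_lt_highVal i)

lemma Asc.star_lt_star {σ : BlockState n} {i : Fin (n - 1)} (h : σ.Asc i)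
    (hb : σ.blk (lowVal i) = σ.blk (highVal i)) : σ.star (lowVal i) < σ.star (highVal i) :=
  h.resolve_left hb.not_lt |>.2

lemma eq_of_adjSwap_eq_lowVal {i : Fin (n - 1)} {x : Fin n} (h : adjSwap i x = lowVal i) :
    x = highVal i := by
  rw [← adjSwap_apply_apply i x, h, adjSwap_lowVal]

lemma eq_of_adjSwap_eq_highVal {i : Fin (n - 1)} {x : Fin n} (h : adjSwap i x = highVal i) :
    x = lowVal i := by
  rw [← adjSwap_apply_apply i x, h, adjSwap_highVal]

lemma lowVal_lt_iff {i : Fin (n - 1)} {x : Fin n} : lowVal i < x ↔ highVal i ≤ x := by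
  rw [Fin.lt_def, Fin.le_def, val_lowVal, val_highVal]
  omega

lemma lt_highVal_iff {i : Fin (n - 1)} {x : Fin n} : x < highVal i ↔ x ≤ lowVal i := by
  rw [Fin.lt_def, Fin.le_def, val_lowVal, val_highVal]
  omega

lemma IsAtom.le_of_le_star {b₀ : Fin n → ℕ} {w : Perm (Fin n)} {σ : BlockState n}
    (h : IsAtom b₀ w σ) {a : Fin n} (ha : a ≤ σ.star a) : w (σ.star a) ≤ w a := by
  rcases ha.eq_or_lt with e | hlt
  · rw [← e]
  · exact (h.desc a hlt).le

/-- Relabelling by `s_i` preserves all comparisons of values except that of `i` with `i+1`. The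
exceptional cases concern the cycles of these two values within one block, where the ascent orders
the partners and `cross` decides. -/
lemma IsAtom.conjSwap {b₀ : Fin n → ℕ} {w : Perm (Fin n)} {σ : BlockState n}
    (h : IsAtom b₀ w σ) (hσ : σ.Valid) {i : Fin (n - 1)} (hasc : σ.Asc i)
    (h₂ : ¬(σ.star (lowVal i) = lowVal i ∧ σ.star (highVal i) = highVal i ∧
      σ.blk (lowVal i) = σ.blk (highVal i))) : IsAtom b₀ (w * adjSwap i) (σ.conjSwap i) := by
  have hne := hasc.star_ne hσ
  have hlh := lowVal_lt_highVal i
  have hle : ∀ a, a ≤ adjSwap i (σ.star (adjSwap i a)) → adjSwap i a ≤ σ.star (adjSwap i a) := by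
    intro a ha
    rcases ha.eq_or_lt with e | hlt
    · have := congrArg (adjSwap i) e
      rw [adjSwap_apply_apply] at this
      exact this.le
    · rcases lt_or_of_lt i hlt with h' | ⟨e₁, e₂⟩
      · rw [adjSwap_apply_apply] at h'
        exact h'.le
      · rw [e₁, adjSwap_lowVal] at e₂
        exact absurd (eq_of_adjSwap_eq_highVal e₂) hne
  constructor
  · intro x
    exact h.blk_eq _
  · intro a ha
    simp only [BlockState.conjSwap, Perm.mul_apply, adjSwap_apply_apply] at ha ⊢
    refine h.desc _ (lt_of_le_of_ne (hle a ha.le) fun e => ha.ne ?_)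
    rw [← e, adjSwap_apply_apply]
  · intro a e hae hea hb
    simp only [BlockState.conjSwap, Perm.mul_apply, adjSwap_apply_apply] at hae hea hb ⊢
    rcases lt_or_of_lt i hae with h' | ⟨rfl, rfl⟩
    · rcases lt_or_of_lt i hea with h'' | ⟨rfl, e₂⟩
      · rw [adjSwap_apply_apply] at h''
        exact h.not_between _ _ h' h'' hb
      · have e₃ := eq_of_adjSwap_eq_highVal e₂
        rw [adjSwap_lowVal] at hb h' ⊢
        set A := adjSwap i a with hA
        have e₄ : σ.star (lowVal i) = A := by rw [← e₃, hσ.star_star]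
        have hAne : A ≠ lowVal i := by
          intro e
          rw [hA] at e
          rw [eq_of_adjSwap_eq_lowVal e] at hae
          exact lt_asymm hae hlh
        have hAlt : A < lowVal i := lt_of_le_of_ne (lt_highVal_iff.1 h') hAne
        have hb' : σ.blk (lowVal i) = σ.blk (highVal i) := by rw [hb, ← e₃, hσ.blk_star]
        have hs := hasc.star_lt_star hb'
        rw [e₃]
        rintro ⟨h₃, h₄⟩
        rw [e₄] at hs
        -- The cycle `{A, i}` becomes `{A, i+1}` and now surrounds the former `i+1`. Whichever end
        -- of its own cycle that value is, `cross` puts `A` before it.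
        rcases le_or_gt (highVal i) (σ.star (highVal i)) with h₅ | h₅
        · have h₆ := h.cross A (highVal i) hb.symm (by rw [e₃]; exact hAlt.le) h₅ h'
            (by rw [e₃]; exact hlh.trans_le h₅)
          exact lt_asymm h₄ (h₆.trans_le (h.le_of_le_star h₅))
        · have h₆ := h.cross A (σ.star (highVal i)) (by rw [hσ.blk_star, hb])
            (by rw [e₃]; exact hAlt.le) (by rw [hσ.star_star]; exact h₅.le) hs
            (by rw [e₃, hσ.star_star]; exact hlh)
          rw [hσ.star_star] at h₆
          exact lt_asymm h₄ h₆
    · rcases lt_or_of_lt i hea with h'' | ⟨e₁, -⟩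
      · simp only [adjSwap_lowVal, adjSwap_highVal, adjSwap_apply_apply] at h'' hb ⊢
        have hs := hasc.star_lt_star hb
        have h₅ := lowVal_lt_iff.1 h''
        rintro ⟨h₃, -⟩
        refine lt_asymm h₃ ?_
        rcases le_or_gt (lowVal i) (σ.star (lowVal i)) with h₆ | h₆
        · exact h.cross _ _ hb h₆ h₅ hlh hs
        · have h₇ := h.cross (σ.star (lowVal i)) (highVal i) (by rw [hσ.blk_star, hb])
            (by rw [hσ.star_star]; exact h₆.le) h₅ (h₆.trans hlh) (by rw [hσ.star_star]; exact h'')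
          have h₈ := h.desc (σ.star (lowVal i)) (by rw [hσ.star_star]; exact h₆)
          rw [hσ.star_star] at h₈
          exact h₈.trans h₇
      · exact absurd e₁ hlh.ne'
  · intro a c hb ha hc hac hs
    simp only [BlockState.conjSwap, Perm.mul_apply, adjSwap_apply_apply] at hb ha hc hac hs ⊢
    have ha' := hle a ha
    have hc' := hle c hc
    rcases lt_or_of_lt i hac with h' | ⟨rfl, rfl⟩
    · rcases lt_or_of_lt i hs with h'' | ⟨e₁, e₂⟩
      · simp only [adjSwap_apply_apply] at h''
        exact h.cross _ _ hb ha' hc' h' h''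
      · have e₁ := eq_of_adjSwap_eq_lowVal e₁
        have e₂ := eq_of_adjSwap_eq_highVal e₂
        rw [← hσ.blk_star (adjSwap i a), ← hσ.blk_star (adjSwap i c), e₁, e₂] at hb
        have h₃ := hasc.star_lt_star hb.symm
        rw [← e₁, ← e₂, hσ.star_star, hσ.star_star] at h₃
        exact absurd h₃ (lt_asymm h')
    · simp only [adjSwap_lowVal, adjSwap_highVal] at hb hs
      have h₃ := hasc.star_lt_star hb.symm
      rcases lt_or_of_lt i hs with h'' | ⟨e₁, e₂⟩
      · simp only [adjSwap_apply_apply] at h''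
        exact absurd h'' (lt_asymm h₃)
      · exact absurd ⟨eq_of_adjSwap_eq_highVal e₂, eq_of_adjSwap_eq_lowVal e₁, hb.symm⟩ h₂

/-- Two fixed points become a 2-cycle with no value between them, and `hw` is its descent condition.
For every other cycle, `i` and `i+1` lie on the same side of each of its values. -/
lemma IsAtom.rowSwap {b₀ : Fin n → ℕ} {w : Perm (Fin n)} {σ : BlockState n}
    (h : IsAtom b₀ w σ) {i : Fin (n - 1)}
    (hw : w (lowVal i) < w (highVal i)) (h₀ : σ.star (lowVal i) = lowVal i)
    (h₁ : σ.star (highVal i) = highVal i) (hb : σ.blk (lowVal i) = σ.blk (highVal i)) :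
    IsAtom b₀ (w * adjSwap i) (σ.rowSwap i) := by
  have hlh := lowVal_lt_highVal i
  have hsl : ∀ x, x ≠ lowVal i → σ.star x ≠ lowVal i := fun x hx e =>
    hx (σ.star.injective (e.trans h₀.symm))
  have hsh : ∀ x, x ≠ highVal i → σ.star x ≠ highVal i := fun x hx e =>
    hx (σ.star.injective (e.trans h₁.symm))
  have hblk : ∀ y, σ.blk (adjSwap i y) = σ.blk y := by
    intro y
    rcases adjSwap_cases i y with ⟨hy, ey⟩ | ⟨hy, ey⟩ | ⟨hy, hy', ey⟩ <;> rw [ey] <;> simp [hy, hb]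
  constructor
  · intro x
    exact h.blk_eq _
  · intro a ha
    simp only [BlockState.rowSwap, Perm.mul_apply] at ha ⊢
    rcases adjSwap_cases i a with ⟨rfl, ea⟩ | ⟨rfl, ea⟩ | ⟨hx, hx', ea⟩ <;> rw [ea] at ha ⊢
    · rw [h₁, adjSwap_highVal]
      exact hw
    · rw [h₀] at ha
      exact absurd ha (lt_asymm hlh)
    · rw [adjSwap_of_ne (hsl a hx) (hsh a hx')]
      exact h.desc a ha
  · intro a e hae hea hb'
    simp only [BlockState.rowSwap, Perm.mul_apply, hblk] at hae hea hb' ⊢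
    rcases adjSwap_cases i a with ⟨rfl, ea⟩ | ⟨rfl, ea⟩ | ⟨hx, hx', ea⟩ <;> rw [ea] at hea ⊢
    · rw [h₁] at hea
      exact absurd (lowVal_lt_iff.1 hae) (not_le.2 hea)
    · rw [h₀] at hea
      exact absurd (hae.trans hea) (lt_asymm hlh)
    · rw [adjSwap_of_ne (hsl a hx) (hsh a hx')]
      rcases adjSwap_cases i e with ⟨rfl, ee⟩ | ⟨rfl, ee⟩ | ⟨hy, hy', ee⟩ <;> rw [ee]
      · exact h.not_between a _ (hae.trans hlh)
          (lt_of_le_of_ne (lowVal_lt_iff.1 hea) (hsh a hx').symm) (hb.symm.trans hb')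
      · exact h.not_between a _ (lt_of_le_of_ne (lt_highVal_iff.1 hae) hx)
          (hlh.trans hea) (hb.trans hb')
      · exact h.not_between a e hae hea hb'
  · intro a c hb' ha hc hac hs
    simp only [BlockState.rowSwap, Perm.mul_apply, hblk] at hb' ha hc hac hs ⊢
    rcases adjSwap_cases i a with ⟨rfl, ea⟩ | ⟨rfl, ea⟩ | ⟨hx, hx', ea⟩ <;> rw [ea] at ha hs ⊢
    · rcases adjSwap_cases i c with ⟨rfl, ec⟩ | ⟨rfl, ec⟩ | ⟨hy, hy', ec⟩ <;> rw [ec] at hc hs ⊢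
      · exact absurd hac (lt_irrefl _)
      · rw [h₀] at hc
        exact absurd hc (not_le.2 hlh)
      · rw [adjSwap_of_ne (hsl c hy) (hsh c hy')]
        exact h.cross _ _ (hb.symm.trans hb') h₁.ge hc
          (lt_of_le_of_ne (lowVal_lt_iff.1 hac) hy'.symm) hs
    · rw [h₀] at ha
      exact absurd ha (not_le.2 hlh)
    · rcases adjSwap_cases i c with ⟨rfl, ec⟩ | ⟨rfl, ec⟩ | ⟨hy, hy', ec⟩ <;> rw [ec] at hc hs ⊢
      · rw [h₁] at hs ⊢
        rw [adjSwap_highVal]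
        have := h.cross a (lowVal i) hb' ha h₀.ge hac
          (by rw [h₀]; exact lt_of_le_of_ne (lt_highVal_iff.1 hs) (hsl a hx))
        rwa [h₀] at this
      · rw [h₀] at hc
        exact absurd hc (not_le.2 hlh)
      · rw [adjSwap_of_ne (hsl c hy) (hsh c hy')]
        exact h.cross a c hb' ha hc hac hs

lemma IsAtom.act {b₀ : Fin n → ℕ} {w : Perm (Fin n)} {σ : BlockState n}
    (h : IsAtom b₀ w σ) (hσ : σ.Valid) {i : Fin (n - 1)} (hasc : σ.Asc i)
    (hw : w (lowVal i) < w (highVal i)) : IsAtom b₀ (w * adjSwap i) (σ.act i) := by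
  rw [BlockState.act, if_pos hasc]
  split_ifs with h₂
  · exact h.rowSwap hw h₂.1 h₂.2.1 h₂.2.2
  · exact h.conjSwap hσ hasc h₂

/-- Strict words are reduced words of atoms. -/
lemma Strict.isAtom {m : ℕ → ℕ} {b₀ : Fin n → ℕ} (hm : Cuts m b₀) {a : List (Fin (n - 1))}
    {σ : BlockState n} (ha : Strict b₀ a σ) :
    invCount (wordProd a) = a.length ∧ MaxForm m (wordProd a) σ ∧ IsAtom b₀ (wordProd a) σ := by
  induction ha with
  | nil => exact ⟨by simp, maxForm_base hm, isAtom_base b₀⟩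
  | @snoc a σ i ha hasc ih =>
    obtain ⟨h₁, h₂, h₃⟩ := ih
    have hlt : wordProd a (lowVal i) < wordProd a (highVal i) := by
      by_contra hcon
      -- If the letter were a descent of the permutation, the same permutation would lead both to
      -- `σ` and to the strictly larger `σ.act i`.
      have h₄ := h₂.act ha.valid i
      rw [heckeMul, if_neg hcon] at h₄
      exact (hasc.lt_act ha.valid).ne (h₂.eq h₄)
    rw [wordProd_append_singleton, invCount_mul_adjSwap hlt]
    refine ⟨by simp [h₁], ?_, h₃.act ha.valid hasc hlt⟩
    have h₄ := h₂.act ha.valid i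
    rwa [heckeMul, if_pos hlt] at h₄

end BlockState

/-! ## Covers of atoms -/

namespace BlockState
variable {n : ℕ}

/-- Up to the block `β` and the thresholds `p ≤ q`, the cycle of `x` counts for the rank. -/
def Low (σ : BlockState n) (β p q : ℕ) (x : Fin n) : Prop :=
  σ.blk x < β ∨ σ.blk x = β ∧ ((x : ℕ) < p ∨ (σ.star x : ℕ) < p) ∧ (x : ℕ) < q ∧
    (σ.star x : ℕ) < q

/-- The cycle of `x` lies beyond the block `β` and the thresholds `p ≤ q`. -/
def High (σ : BlockState n) (β p q : ℕ) (x : Fin n) : Prop :=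
  β < σ.blk x ∨ σ.blk x = β ∧ p ≤ x ∧ p ≤ σ.star x ∧ (q ≤ x ∨ q ≤ σ.star x)

lemma Low.star {σ : BlockState n} (hσ : σ.Valid) {β p q : ℕ} {x : Fin n} (h : σ.Low β p q x) :
    σ.Low β p q (σ.star x) := by
  unfold Low at *
  rw [hσ.blk_star, hσ.star_star]
  tauto

lemma High.star {σ : BlockState n} (hσ : σ.Valid) {β p q : ℕ} {x : Fin n}
    (h : σ.High β p q x) : σ.High β p q (σ.star x) := by
  unfold High at *
  rw [hσ.blk_star, hσ.star_star]
  tauto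

section
variable {m : ℕ → ℕ} {b₀ : Fin n → ℕ} {w : Perm (Fin n)} {σ : BlockState n}

lemma IsAtom.lt_iff (h : IsAtom b₀ w σ) (hm : Cuts m b₀) (x : Fin n) (β : ℕ) :
    σ.blk x < β ↔ (w x : ℕ) < m β := by
  rw [h.blk_eq, hm.lt_iff]

lemma IsAtom.lt_of_blk_lt (h : IsAtom b₀ w σ) (hm : Cuts m b₀) {x y : Fin n}
    (hxy : σ.blk x < σ.blk y) : w x < w y := by
  by_contra hcon
  have := hm.monotone (not_lt.1 hcon)
  rw [← h.blk_eq, ← h.blk_eq] at this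
  omega

lemma IsAtom.blk_le_of_le (h : IsAtom b₀ w σ) (hm : Cuts m b₀) {x y : Fin n}
    (hxy : w x ≤ w y) : σ.blk x ≤ σ.blk y := by
  rw [h.blk_eq, h.blk_eq]
  exact hm.monotone hxy

/-- The smaller element of a cycle comes last. -/
lemma IsAtom.exists_min (h : IsAtom b₀ w σ) (hσ : σ.Valid) (x : Fin n) :
    ∃ c, (c = x ∨ c = σ.star x) ∧ c ≤ σ.star c ∧ w x ≤ w c := by
  rcases le_or_gt x (σ.star x) with hx | hx
  · exact ⟨x, Or.inl rfl, hx, le_rfl⟩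
  · refine ⟨σ.star x, Or.inr rfl, by rw [hσ.star_star]; exact hx.le, ?_⟩
    have := h.desc (σ.star x) (by rwa [hσ.star_star])
    rw [hσ.star_star] at this
    exact this.le

/-- The larger element of a cycle comes first. -/
lemma IsAtom.exists_max (h : IsAtom b₀ w σ) (hσ : σ.Valid) (x : Fin n) :
    ∃ c, (c = x ∨ c = σ.star x) ∧ σ.star c ≤ c ∧ w c ≤ w x := by
  rcases le_or_gt (σ.star x) x with hx | hx
  · exact ⟨x, Or.inl rfl, hx, le_rfl⟩
  · exact ⟨σ.star x, Or.inr rfl, by rw [hσ.star_star]; exact hx.le, (h.desc x hx).le⟩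

/-- `cross` compares the last element of the first cycle, its minimum, with the first element of the
second, its maximum; so the whole first cycle precedes the whole second one. -/
lemma IsAtom.cross_of_min (h : IsAtom b₀ w σ) (hσ : σ.Valid) {x y : Fin n}
    (hb : σ.blk x = σ.blk y) (h₁ : min x (σ.star x) < min y (σ.star y))
    (h₂ : max x (σ.star x) < max y (σ.star y)) : w x < w y := by
  obtain ⟨a, ha, ha', hxa⟩ := h.exists_min hσ x
  obtain ⟨c, hc, hc', hcy⟩ := h.exists_max hσ y
  have ea : min x (σ.star x) = a ∧ max x (σ.star x) = σ.star a ∧ σ.blk x = σ.blk a := by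
    rcases ha with rfl | rfl
    · exact ⟨min_eq_left ha', max_eq_right ha', rfl⟩
    · rw [hσ.star_star] at ha' ⊢
      exact ⟨min_eq_right ha', max_eq_left ha', (hσ.blk_star x).symm⟩
  have ec : min y (σ.star y) = σ.star c ∧ max y (σ.star y) = c ∧ σ.blk y = σ.blk c := by
    rcases hc with rfl | rfl
    · exact ⟨min_eq_right hc', max_eq_left hc', rfl⟩
    · rw [hσ.star_star] at hc' ⊢
      exact ⟨min_eq_left hc', max_eq_right hc', (hσ.blk_star y).symm⟩
  rw [ea.1, ec.1] at h₁
  rw [ea.2.1, ec.2.1] at h₂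
  have := h.cross a (σ.star c) (by rw [hσ.blk_star, ← ea.2.2, ← ec.2.2, hb]) ha'
    (by rw [hσ.star_star]; exact hc') h₁ (by rwa [hσ.star_star])
  rw [hσ.star_star] at this
  exact hxa.trans_lt (this.trans_le hcy)

/-- Within block `β` the minima of the two cycles are separated by `p` and the maxima by `q`, so
`cross_of_min` applies. -/
lemma IsAtom.low_lt_high (h : IsAtom b₀ w σ) (hσ : σ.Valid) (hm : Cuts m b₀) {β p q : ℕ}
    {x y : Fin n} (hx : σ.Low β p q x) (hy : σ.High β p q y) : w x < w y := by
  by_cases hb : σ.blk x < σ.blk y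
  · exact h.lt_of_blk_lt hm hb
  · unfold Low at hx
    unfold High at hy
    apply h.cross_of_min hσ
    · omega
    · rw [lt_min_iff, min_lt_iff, min_lt_iff]
      simp only [Fin.lt_def]
      omega
    · rw [lt_max_iff, max_lt_iff, max_lt_iff]
      simp only [Fin.lt_def]
      omega

/-- If `e` lies inside the open cycle `{a, star a}`, this is the atom condition; if `e < a`, the
cycle of `e` comes first by crossing. -/
lemma IsAtom.not_between_of_low (h : IsAtom b₀ w σ) (hσ : σ.Valid) (hm : Cuts m b₀)
    {β p q : ℕ} (hpq : p ≤ q) {a e : Fin n} (hb : σ.blk a = β) (hap : (a : ℕ) < p)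
    (haq : q ≤ σ.star a) (he : σ.Low β p q e) : ¬(w (σ.star a) < w e ∧ w e < w a) := by
  rintro ⟨h₁, h₂⟩
  have h₃ := h.blk_le_of_le hm h₁.le
  rw [hσ.blk_star] at h₃
  unfold Low at he
  have hbe : σ.blk e = σ.blk a := by omega
  rcases lt_trichotomy a e with hlt | rfl | hlt
  · exact h.not_between a e hlt (by rw [Fin.lt_def]; omega) hbe ⟨h₁, h₂⟩
  · omega
  · refine lt_asymm h₁ (h.cross_of_min hσ (by rw [hσ.blk_star, hbe]) ?_ ?_)
    · rw [hσ.star_star, lt_min_iff, min_lt_iff, min_lt_iff]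
      simp only [Fin.lt_def] at hlt ⊢
      omega
    · rw [hσ.star_star, lt_max_iff, max_lt_iff, max_lt_iff]
      simp only [Fin.lt_def]
      omega

lemma IsAtom.not_between_of_high (h : IsAtom b₀ w σ) (hσ : σ.Valid) (hm : Cuts m b₀)
    {β p q : ℕ} (hpq : p ≤ q) {a e : Fin n} (hb : σ.blk a = β) (hap : (a : ℕ) < p)
    (haq : q ≤ σ.star a) (he : σ.High β p q e) : ¬(w (σ.star a) < w e ∧ w e < w a) := by
  rintro ⟨h₁, h₂⟩
  have h₃ := h.blk_le_of_le hm h₂.le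
  unfold High at he
  have hbe : σ.blk e = σ.blk a := by omega
  rcases lt_trichotomy (σ.star a) e with hlt | rfl | hlt
  · refine lt_asymm h₂ (h.cross_of_min hσ hbe.symm ?_ ?_)
    · rw [lt_min_iff, min_lt_iff, min_lt_iff]
      simp only [Fin.lt_def] at hlt ⊢
      omega
    · rw [lt_max_iff, max_lt_iff, max_lt_iff]
      simp only [Fin.lt_def] at hlt ⊢
      omega
  · exact lt_irrefl _ h₁
  · exact h.not_between a e (by rw [Fin.lt_def]; omega) hlt hbe ⟨h₁, h₂⟩

/-! ### The slack of a position -/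

/-- The value at the position `k` of the function whose maximum is the rank. -/
noncomputable def blockValue (m : ℕ → ℕ) (w : Perm (Fin n)) (β p q k : ℕ) : ℤ :=
  m β + permCount w p k + permCount w q k - k

/-- The contribution of `x` to the difference between the rank and the value at `k`. -/
def slack (σ : BlockState n) (w : Perm (Fin n)) (β p q k : ℕ) (x : Fin n) : ℤ :=
  if σ.blk x = β then
    (if (x : ℕ) < p ∧ (σ.star x : ℕ) < q then 1 else 0) -
      if (w x : ℕ) < k then
        ((if (x : ℕ) < p then 1 else 0) + (if (x : ℕ) < q then 1 else 0) - 1) else 0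
  else 0

lemma sum_val_lt (w : Perm (Fin n)) {k : ℕ} (hk : k ≤ n) :
    ∑ x : Fin n, (if (w x : ℕ) < k then 1 else 0 : ℤ) = k := by
  rw [Equiv.sum_comp w (fun y => (if (y : ℕ) < k then 1 else 0 : ℤ))]
  have := countBelow_val_lt (n := n) (k := k) (p := k) (by omega)
  rw [min_self] at this
  rw [← this, countBelow]
  exact Finset.sum_congr rfl fun x _ => by simp

/-- The identity holds term by term: since `k` is a cut of block `β`, values of earlier blocks have
all been passed and those of later blocks have not, and both contribute zero. -/
lemma IsAtom.sum_slack (h : IsAtom b₀ w σ) (hσ : σ.Valid) (hm : Cuts m b₀) (β p q : ℕ) {k : ℕ}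
    (h₁ : m β ≤ k) (h₂ : k ≤ m (β + 1)) :
    ∑ x, slack σ w β p q k x = σ.rank β p q - blockValue m w β p q k := by
  classical
  have hle := hm.le (β + 1)
  have e₁ : ∀ y, σ.blk (σ.star⁻¹ y) = σ.blk y := fun y => by
    rw [← hσ.blk_star (σ.star⁻¹ y), Perm.coe_inv, Equiv.apply_symm_apply]
  have e₂ := sum_val_lt w (h₂.trans hle)
  have e₃ := sum_val_lt w (hm.le β)
  rw [blockValue, rank, ← e₂, ← e₃]
  simp only [e₁, permCount, countBelow]
  rw [← Finset.sum_add_distrib, ← Finset.sum_add_distrib, ← Finset.sum_add_distrib,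
    ← Finset.sum_sub_distrib, ← Finset.sum_sub_distrib]
  refine Finset.sum_congr rfl fun x _ => ?_
  have h₃ := h.lt_iff hm x β
  have h₄ := h.lt_iff hm x (β + 1)
  unfold slack KeyBelow
  simp only [← h₃]
  by_cases c₁ : σ.blk x < β
  · have c₂ : (w x : ℕ) < k := by omega
    simp [c₁, c₁.ne, c₂]
    ring
  · by_cases c₃ : σ.blk x = β
    · by_cases c₂ : (w x : ℕ) < k
      · simp [c₃, c₂]
      · simp [c₃, c₂]
    · have c₂ : ¬(w x : ℕ) < k := by omega
      simp [c₁, c₃, c₂]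

/-- The slack of the cycle of `x`. -/
def defect (σ : BlockState n) (w : Perm (Fin n)) (β p q k : ℕ) (x : Fin n) : ℤ :=
  slack σ w β p q k x + slack σ w β p q k (σ.star x)

lemma IsAtom.sum_defect (h : IsAtom b₀ w σ) (hσ : σ.Valid) (hm : Cuts m b₀) (β p q : ℕ) {k : ℕ}
    (h₁ : m β ≤ k) (h₂ : k ≤ m (β + 1)) :
    ∑ x, defect σ w β p q k x = 2 * (σ.rank β p q - blockValue m w β p q k) := by
  unfold defect
  rw [Finset.sum_add_distrib, Equiv.sum_comp σ.star (fun x => slack σ w β p q k x),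
    h.sum_slack hσ hm β p q h₁ h₂]
  ring

/-- For `p ≤ q`, the coefficient of `[w x < k]` in `slack` is `-1`, `0` or `1` as `x < p`, `p ≤ x <
q` or `q ≤ x`. Only an open cycle, with one end below `p` and the other at least `q`, could be
negative, and `desc` prevents this by placing the larger end first. -/
lemma IsAtom.defect_nonneg (h : IsAtom b₀ w σ) (hσ : σ.Valid) {β p q : ℕ} (hpq : p ≤ q) (k : ℕ)
    (x : Fin n) : 0 ≤ defect σ w β p q k x := by
  have d₁ := h.desc x
  have d₂ := h.desc (σ.star x)
  have d₃ : x = σ.star x → w x = w (σ.star x) := fun e => congrArg w e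
  unfold defect slack
  rw [hσ.blk_star]
  rw [hσ.star_star] at d₂ ⊢
  rw [Fin.lt_def, Fin.lt_def] at d₁ d₂
  rw [Fin.ext_iff, Fin.ext_iff] at d₃
  split_ifs <;> omega

lemma defect_eq_zero (hσ : σ.Valid) {β p q k : ℕ} (hpq : p ≤ q)
    {x : Fin n} (h₁ : σ.blk x = β → σ.Low β p q x → (w x : ℕ) < k ∧ (w (σ.star x) : ℕ) < k)
    (h₂ : σ.blk x = β → σ.High β p q x → k ≤ w x ∧ k ≤ w (σ.star x))
    (h₃ : σ.blk x = β → (x : ℕ) < p → q ≤ σ.star x → ((w x : ℕ) < k ↔ (w (σ.star x) : ℕ) < k))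
    (h₄ : σ.blk x = β → (σ.star x : ℕ) < p → q ≤ x → ((w x : ℕ) < k ↔ (w (σ.star x) : ℕ) < k)) :
    defect σ w β p q k x = 0 := by
  unfold Low at h₁
  unfold High at h₂
  unfold defect slack
  rw [hσ.blk_star, hσ.star_star]
  split_ifs <;> omega

lemma IsAtom.lt_of_defect_eq_zero (h : IsAtom b₀ w σ) (hσ : σ.Valid) {β p q k : ℕ}
    (hpq : p ≤ q) {x : Fin n} (hd : defect σ w β p q k x = 0) (hb : σ.blk x = β)
    (hx : σ.Low β p q x) : (w x : ℕ) < k := by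
  have d₁ := h.desc x
  have d₂ := h.desc (σ.star x)
  unfold Low at hx
  unfold defect slack at hd
  rw [hσ.blk_star] at hd
  rw [hσ.star_star] at d₂ hd
  rw [Fin.lt_def, Fin.lt_def] at d₁ d₂
  have d₃ : x = σ.star x → w x = w (σ.star x) := fun e => congrArg w e
  rw [Fin.ext_iff, Fin.ext_iff] at d₃
  split_ifs at hd <;> omega

lemma IsAtom.le_of_defect_eq_zero (h : IsAtom b₀ w σ) (hσ : σ.Valid) {β p q k : ℕ}
    (hpq : p ≤ q) {x : Fin n} (hd : defect σ w β p q k x = 0) (hb : σ.blk x = β)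
    (hx : σ.High β p q x) : k ≤ w x := by
  have d₁ := h.desc x
  have d₂ := h.desc (σ.star x)
  unfold High at hx
  unfold defect slack at hd
  rw [hσ.blk_star] at hd
  rw [hσ.star_star] at d₂ hd
  rw [Fin.lt_def, Fin.lt_def] at d₁ d₂
  have d₃ : x = σ.star x → w x = w (σ.star x) := fun e => congrArg w e
  rw [Fin.ext_iff, Fin.ext_iff] at d₃
  split_ifs at hd <;> omega

end

end BlockState

/-! ### Cuts at which the rank is attained -/

namespace BlockState
variable {n : ℕ} {m : ℕ → ℕ} {b₀ : Fin n → ℕ} {w : Perm (Fin n)} {σ : BlockState n}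

lemma IsAtom.blockValue_le (h : IsAtom b₀ w σ) (hσ : σ.Valid) (hm : Cuts m b₀) {β p q : ℕ}
    (hpq : p ≤ q) {k : ℕ} (h₁ : m β ≤ k) (h₂ : k ≤ m (β + 1)) :
    blockValue m w β p q k ≤ σ.rank β p q := by
  have h₃ := h.sum_defect hσ hm β p q h₁ h₂
  have h₄ : 0 ≤ ∑ x, defect σ w β p q k x :=
    Finset.sum_nonneg fun x _ => h.defect_nonneg hσ hpq k x
  omega

/-- At a position where the maximum is attained, all low elements have been passed and no high
element has. -/
lemma IsAtom.of_blockValue_eq (h : IsAtom b₀ w σ) (hσ : σ.Valid) (hm : Cuts m b₀) {β p q : ℕ}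
    (hpq : p ≤ q) {k : ℕ} (h₁ : m β ≤ k) (h₂ : k ≤ m (β + 1))
    (hk : blockValue m w β p q k = σ.rank β p q) :
    (∀ x, σ.Low β p q x → (w x : ℕ) < k) ∧ ∀ x, σ.High β p q x → k ≤ w x := by
  have h₃ := h.sum_defect hσ hm β p q h₁ h₂
  rw [hk, sub_self, mul_zero,
    Finset.sum_eq_zero_iff_of_nonneg fun x _ => h.defect_nonneg hσ hpq k x] at h₃
  constructor
  · intro x hx
    by_cases hb : σ.blk x = β
    · exact h.lt_of_defect_eq_zero hσ hpq (h₃ x (Finset.mem_univ x)) hb hx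
    · have h₄ := h.lt_iff hm x β
      unfold Low at hx
      omega
  · intro x hx
    by_cases hb : σ.blk x = β
    · exact h.le_of_defect_eq_zero hσ hpq (h₃ x (Finset.mem_univ x)) hb hx
    · have h₄ := h.lt_iff hm x (β + 1)
      unfold High at hx
      omega

lemma IsAtom.blockValue_eq (h : IsAtom b₀ w σ) (hσ : σ.Valid) (hm : Cuts m b₀) {β p q : ℕ}
    (hpq : p ≤ q) {k : ℕ} (h₁ : m β ≤ k) (h₂ : k ≤ m (β + 1))
    (hlow : ∀ x, σ.Low β p q x → (w x : ℕ) < k) (hhigh : ∀ x, σ.High β p q x → k ≤ w x)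
    (hopen : ∀ a, σ.blk a = β → (a : ℕ) < p → q ≤ σ.star a → (w (σ.star a) : ℕ) < k →
      (w a : ℕ) < k) :
    blockValue m w β p q k = σ.rank β p q := by
  have h₃ := h.sum_defect hσ hm β p q h₁ h₂
  rw [Finset.sum_eq_zero fun x _ => ?_] at h₃
  · omega
  · refine defect_eq_zero hσ hpq (fun _ hx => ⟨hlow x hx, hlow _ (hx.star hσ)⟩)
      (fun _ hx => ⟨hhigh x hx, hhigh _ (hx.star hσ)⟩) (fun hb hp hq => ?_) (fun hb hp hq => ?_)
    · have := hopen x hb hp hq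
      have d := h.desc x (by rw [Fin.lt_def]; omega)
      rw [Fin.lt_def] at d
      omega
    · have := hopen (σ.star x) (by rw [hσ.blk_star, hb]) hp (by rwa [hσ.star_star])
      have d := h.desc (σ.star x) (by rw [hσ.star_star, Fin.lt_def]; omega)
      rw [hσ.star_star] at this d
      rw [Fin.lt_def] at d
      omega

/-- The maximum is attained just after the last low element. -/
lemma IsAtom.exists_first (h : IsAtom b₀ w σ) (hσ : σ.Valid) (hm : Cuts m b₀) {β p q : ℕ}
    (hpq : p ≤ q) : ∃ k, m β ≤ k ∧ k ≤ m (β + 1) ∧ blockValue m w β p q k = σ.rank β p q ∧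
      ∀ r : ℕ, (∀ x, σ.Low β p q x → (w x : ℕ) < r) → k ≤ r := by
  classical
  have hex : ∃ k : ℕ, ∀ x, σ.Low β p q x → (w x : ℕ) < k := ⟨n, fun x _ => (w x).isLt⟩
  obtain ⟨k, hk, hmin⟩ : ∃ k : ℕ, (∀ x, σ.Low β p q x → (w x : ℕ) < k) ∧
      ∀ r : ℕ, (∀ x, σ.Low β p q x → (w x : ℕ) < r) → k ≤ r :=
    ⟨Nat.find hex, Nat.find_spec hex, fun r hr => Nat.find_min' hex hr⟩
  -- `k` is one past the position of the last low element, or 0 when there is none.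
  have hlast : k = 0 ∨ ∃ x, σ.Low β p q x ∧ (w x : ℕ) + 1 = k := by
    by_contra! hcon
    have := hmin (k - 1) fun x hx => by
      have h₁ := hk x hx
      have h₂ := hcon.2 x hx
      omega
    omega
  have h₁ : m β ≤ k := by
    by_contra! hcon
    have hn := hm.le β
    have h₁ := h.lt_iff hm (w.symm ⟨k, by omega⟩) β
    have h₂ := hk (w.symm ⟨k, by omega⟩) (Or.inl (h₁.2 (by simpa using hcon)))
    simp at h₂
  have h₂ : k ≤ m (β + 1) := by
    rcases hlast with h₃ | ⟨x, hx, h₃⟩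
    · omega
    · have := (h.lt_iff hm x (β + 1)).1 (by unfold Low at hx; omega)
      omega
  refine ⟨k, h₁, h₂, h.blockValue_eq hσ hm hpq h₁ h₂ hk (fun y hy => ?_) ?_, hmin⟩
  · rcases hlast with h₃ | ⟨x, hx, h₃⟩
    · omega
    · have := h.low_lt_high hσ hm hx hy
      rw [Fin.lt_def] at this
      omega
  -- An open cycle split by the cut would have the last low element between its two positions.
  · intro a hb hp hq hlt
    rcases hlast with h₃ | ⟨x, hx, h₃⟩
    · omega
    · by_contra hcon
      refine h.not_between_of_low hσ hm hpq hb hp hq hx ?_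
      have hne : (w (σ.star a) : ℕ) ≠ w x := fun e => by
        have e' := w.injective (Fin.ext e)
        rw [← e'] at hx
        unfold Low at hx
        rw [hσ.blk_star] at hx
        omega
      have hne' : (w a : ℕ) ≠ w x := fun e => by
        have e' := w.injective (Fin.ext e)
        rw [← e'] at hx
        unfold Low at hx
        omega
      rw [Fin.lt_def, Fin.lt_def]
      omega

/-- The maximum is attained just before the first high element. -/
lemma IsAtom.exists_last (h : IsAtom b₀ w σ) (hσ : σ.Valid) (hm : Cuts m b₀) {β p q : ℕ}
    (hpq : p ≤ q) : ∃ k, m β ≤ k ∧ k ≤ m (β + 1) ∧ blockValue m w β p q k = σ.rank β p q ∧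
      ∀ r : ℕ, r ≤ n → (∀ x, σ.High β p q x → r ≤ w x) → r ≤ k := by
  classical
  obtain ⟨k, hkn, hk, hmax⟩ : ∃ k : ℕ, k ≤ n ∧ (∀ x, σ.High β p q x → k ≤ w x) ∧
      ∀ r : ℕ, r ≤ n → (∀ x, σ.High β p q x → r ≤ w x) → r ≤ k :=
    ⟨Nat.findGreatest (fun k => ∀ x, σ.High β p q x → k ≤ w x) n, Nat.findGreatest_le n,
      Nat.findGreatest_spec (P := fun k => ∀ x, σ.High β p q x → k ≤ w x) (Nat.zero_le n)
        (fun x _ => Nat.zero_le _), fun r hr h => Nat.le_findGreatest hr h⟩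
  have hfirst : k = n ∨ ∃ x, σ.High β p q x ∧ (w x : ℕ) = k := by
    by_contra! hcon
    have := hmax (k + 1) (by omega) fun x hx => by
      have h₁ := hk x hx
      have h₂ := hcon.2 x hx
      omega
    omega
  have h₂ : k ≤ m (β + 1) := by
    by_contra! hcon
    have h₁ := h.lt_iff hm (w.symm ⟨m (β + 1), by omega⟩) (β + 1)
    have h₂ := hk (w.symm ⟨m (β + 1), by omega⟩) (Or.inl (by simp at h₁; omega))
    simp at h₂
    omega
  have h₁ : m β ≤ k := by
    rcases hfirst with h₃ | ⟨x, hx, h₃⟩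
    · have := hm.le β
      omega
    · have := h.lt_iff hm x β
      unfold High at hx
      omega
  refine ⟨k, h₁, h₂, h.blockValue_eq hσ hm hpq h₁ h₂ (fun x hx => ?_) hk ?_, hmax⟩
  · rcases hfirst with h₃ | ⟨y, hy, h₃⟩
    · have := (w x).isLt
      omega
    · have := h.low_lt_high hσ hm hx hy
      rw [Fin.lt_def] at this
      omega
  · intro a hb hp hq hlt
    rcases hfirst with h₃ | ⟨x, hx, h₃⟩
    · have := (w a).isLt
      omega
    · by_contra hcon
      refine h.not_between_of_high hσ hm hpq hb hp hq hx ?_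
      have hne' : (w a : ℕ) ≠ w x := fun e => by
        have e' := w.injective (Fin.ext e)
        rw [← e'] at hx
        unfold High at hx
        omega
      rw [Fin.lt_def, Fin.lt_def]
      omega

/-! ### Exchanging two values of an atom -/

/-- The conditions on `i < j` for `w` to be covered by `w * swap i j`. -/
structure Ascent (w : Perm (Fin n)) (i j : Fin n) : Prop where
  lt : i < j
  map_lt : w i < w j
  not_between : ∀ e, i < e → e < j → ¬(w i < w e ∧ w e < w j)

variable {i j : Fin n} {β p q : ℕ}

/-- Let `c` be the smaller end of the cycle of `x`. If `i` were not low, `w c` would lie strictly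
between `w i` and `w j`, so `c` avoids `(i, j)` and then `c < i`. Either the cycle of `c` precedes
that of `i` by crossing, or it surrounds `i` with its larger end in `(i, j)`, and the `not_between`
conditions of the cover and of the atom conflict. -/
lemma IsAtom.low_of_le (h : IsAtom b₀ w σ) (hσ : σ.Valid) (hm : Cuts m b₀) (hc : Ascent w i j)
    (hpq : p ≤ q) (hd : (i : ℕ) < p ∧ p ≤ j ∨ (i : ℕ) < q ∧ q ≤ j) {x y : Fin n}
    (hx : σ.Low β p q x) (hix : w i ≤ w x) (hy : σ.High β p q y) (hyj : w y ≤ w j) :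
    σ.Low β p q i := by
  by_contra hlow
  have hbx := h.blk_le_of_le hm hix
  have hbi : σ.blk i = β ∧ σ.blk x = β := by
    have h₁ := hlow
    unfold Low at hx h₁
    omega
  obtain ⟨c, hcx, hcc, hwc⟩ := h.exists_min hσ x
  have hcl : σ.Low β p q c ∧ σ.blk c = β := by
    rcases hcx with rfl | rfl
    · exact ⟨hx, hbi.2⟩
    · exact ⟨hx.star hσ, by rw [hσ.blk_star, hbi.2]⟩
  have hwic : w i < w c := lt_of_le_of_ne (hix.trans hwc) fun e => hlow (by
    rw [w.injective e]; exact hcl.1)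
  have hwcj : w c < w j := (h.low_lt_high hσ hm hcl.1 hy).trans_le hyj
  have hnc := hc.not_between c
  have hnd := hc.not_between (σ.star c)
  have hhigh : ¬σ.High β p q i := fun hi => lt_asymm hwic (h.low_lt_high hσ hm hcl.1 hi)
  have hcr := h.cross_of_min hσ (x := c) (y := i) (hcl.2.trans hbi.1.symm)
  have hle := h.le_of_le_star hcc
  have hnb := h.not_between c i
  have hl := hcl.1
  have hne : c ≠ i := by rintro rfl; exact lt_irrefl _ hwic
  have hne' : σ.star c ≠ i := by
    rintro rfl
    exact hlow (hl.star hσ)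
  have hne'' := σ.star.injective.ne hne
  have hwne := w.injective.ne hne'
  unfold Low at hlow hl
  unfold High at hhigh
  rw [min_eq_left hcc, max_eq_right hcc, lt_min_iff, lt_max_iff] at hcr
  simp only [Fin.lt_def, Fin.le_def, ne_eq, Fin.ext_iff] at *
  omega

/-- Mirror image of `low_of_le`, with values and positions reversed. -/
lemma IsAtom.high_of_le (h : IsAtom b₀ w σ) (hσ : σ.Valid) (hm : Cuts m b₀) (hc : Ascent w i j)
    (hpq : p ≤ q) (hd : (i : ℕ) < p ∧ p ≤ j ∨ (i : ℕ) < q ∧ q ≤ j) {x y : Fin n}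
    (hx : σ.Low β p q x) (hix : w i ≤ w x) (hy : σ.High β p q y) (hyj : w y ≤ w j) :
    σ.High β p q j := by
  by_contra hhigh
  have hby := h.blk_le_of_le hm hyj
  have hbj : σ.blk j = β ∧ σ.blk y = β := by
    have h₁ := hhigh
    unfold High at hy h₁
    omega
  obtain ⟨c, hcy, hcc, hwc⟩ := h.exists_max hσ y
  have hch : σ.High β p q c ∧ σ.blk c = β := by
    rcases hcy with rfl | rfl
    · exact ⟨hy, hbj.2⟩
    · exact ⟨hy.star hσ, by rw [hσ.blk_star, hbj.2]⟩
  have hwcj : w c < w j := lt_of_le_of_ne (hwc.trans hyj) fun e => hhigh (by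
    rw [← w.injective e]; exact hch.1)
  have hwic : w i < w c := hix.trans_lt (h.low_lt_high hσ hm hx hch.1)
  have hnc := hc.not_between c
  have hnd := hc.not_between (σ.star c)
  have hlow : ¬σ.Low β p q j := fun hj => lt_asymm hwcj (h.low_lt_high hσ hm hj hch.1)
  have hcr := h.cross_of_min hσ (x := j) (y := c) (hbj.1.trans hch.2.symm)
  have hle := h.le_of_le_star (a := σ.star c) (by rwa [hσ.star_star])
  have hnb := h.not_between (σ.star c) j
  have hl := hch.1
  have hne : c ≠ j := by rintro rfl; exact lt_irrefl _ hwcj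
  have hne' : σ.star c ≠ j := by
    rintro rfl
    exact hhigh (hl.star hσ)
  have hne'' := σ.star.injective.ne hne
  have hwne := w.injective.ne hne'
  unfold High at hhigh hl
  unfold Low at hlow
  rw [min_eq_right hcc, max_eq_left hcc, min_lt_iff, max_lt_iff] at hcr
  rw [hσ.star_star] at hle hnb
  rw [hσ.blk_star] at hnb
  simp only [Fin.lt_def, Fin.le_def, ne_eq, Fin.ext_iff] at *
  omega

/-- The maximum is attained outside of the exchanged positions unless `i` is low and `j` high. -/
lemma IsAtom.exists_outside (h : IsAtom b₀ w σ) (hσ : σ.Valid) (hm : Cuts m b₀)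
    (hc : Ascent w i j) (hpq : p ≤ q) (hd : (i : ℕ) < p ∧ p ≤ j ∨ (i : ℕ) < q ∧ q ≤ j)
    (hn : ¬(σ.Low β p q i ∧ σ.High β p q j)) :
    ∃ k, m β ≤ k ∧ k ≤ m (β + 1) ∧ blockValue m w β p q k = σ.rank β p q ∧
      ¬((w i : ℕ) < k ∧ k ≤ w j) := by
  -- If all low elements come before `i`, the first maximizing cut is at most `w i`; if all high
  -- ones come after `j`, the last exceeds `w j`.
  by_cases h₁ : ∀ x, σ.Low β p q x → (w x : ℕ) < w i
  · obtain ⟨k, hk₁, hk₂, hk, hmin⟩ := h.exists_first hσ hm (β := β) hpq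
    have := hmin _ h₁
    exact ⟨k, hk₁, hk₂, hk, by omega⟩
  · by_cases h₂ : ∀ y, σ.High β p q y → (w j : ℕ) + 1 ≤ w y
    · obtain ⟨k, hk₁, hk₂, hk, hmax⟩ := h.exists_last hσ hm (β := β) hpq
      have := hmax _ (by omega) h₂
      exact ⟨k, hk₁, hk₂, hk, by omega⟩
    · push Not at h₁ h₂
      obtain ⟨x, hx, hx'⟩ := h₁
      obtain ⟨y, hy, hy'⟩ := h₂
      have hix : w i ≤ w x := hx'
      have hyj : w y ≤ w j := by rw [Fin.le_def]; omega
      exact absurd ⟨h.low_of_le hσ hm hc hpq hd hx hix hy hyj,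
        h.high_of_le hσ hm hc hpq hd hx hix hy hyj⟩ hn

/-- Just before a low element `i` that closes its cycle, the value is one below the maximum. -/
lemma IsAtom.le_blockValue_low (h : IsAtom b₀ w σ) (hσ : σ.Valid) (hm : Cuts m b₀)
    (hc : Ascent w i j) (hip : (i : ℕ) < p) (hpq : p ≤ q) (hqj : q ≤ j)
    (hi : σ.Low β p q i) (hj : σ.High β p q j) (hb : σ.blk i = β) (hs : i ≤ σ.star i) :
    m β ≤ w i ∧ (w i : ℕ) ≤ m (β + 1) ∧ σ.rank β p q ≤ blockValue m w β p q (w i) + 1 := by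
  have h₁ : m β ≤ w i := by
    have := h.lt_iff hm i β
    omega
  have h₂ : (w i : ℕ) ≤ m (β + 1) := by
    have := h.lt_iff hm i (β + 1)
    omega
  refine ⟨h₁, h₂, ?_⟩
  have hsum := h.sum_defect hσ hm β p q h₁ h₂
  -- At the cut `w i` only the cycle of `i` has a defect: at most 1 per element, or 2 for a fixed
  -- point, where the two indicators coincide. The total, twice the gap to the rank, is at most 2.
  have hle : ∀ x, defect σ w β p q (w i) x ≤
      (if x = i then 1 else 0) + if x = σ.star i then 1 else 0 := by
    intro x
    by_cases hxi : x = i ∨ x = σ.star i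
    · have hdi : defect σ w β p q (w i) x = defect σ w β p q (w i) i := by
        rcases hxi with rfl | rfl
        · rfl
        · unfold defect
          rw [hσ.star_star, add_comm]
      have key : defect σ w β p q (w i) i ≤ if i = σ.star i then 2 else 1 := by
        have d := h.desc i
        unfold defect slack
        rw [hσ.blk_star, hσ.star_star]
        simp only [Fin.lt_def, Fin.le_def, Fin.ext_iff] at *
        split_ifs <;> omega
      rw [hdi]
      refine key.trans ?_
      rcases hxi with rfl | rfl
      · rw [if_pos rfl]
        split_ifs <;> omega
      · rw [if_pos (rfl : σ.star i = σ.star i)]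
        simp only [eq_comm (a := i)]
        split_ifs <;> omega
    · push Not at hxi
      rw [if_neg hxi.1, if_neg hxi.2, defect_eq_zero hσ hpq]
      · rfl
      -- A low element of another cycle standing after `i` would give a position between `w i` and
      -- `w j`; it is excluded as in `low_of_le`.
      · have main : ∀ x, x ≠ i → x ≠ σ.star i → σ.blk x = β → σ.Low β p q x →
            (w x : ℕ) < w i := by
          intro x hxi hxs hbx hx
          by_contra hcon
          obtain ⟨c, hcx, hcc, hwc⟩ := h.exists_min hσ x
          have hcl : σ.Low β p q c ∧ σ.blk c = β := by
            rcases hcx with rfl | rfl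
            · exact ⟨hx, hbx⟩
            · exact ⟨hx.star hσ, by rw [hσ.blk_star, hbx]⟩
          have hci : c ≠ i ∧ σ.star c ≠ i ∧ σ.star c ≠ σ.star i := by
            have e : ∀ y, σ.star x = y ↔ x = σ.star y := fun y =>
              ⟨fun e => by rw [← e, hσ.star_star], fun e => by rw [e, hσ.star_star]⟩
            rcases hcx with rfl | rfl
            · exact ⟨hxi, fun e' => hxs ((e _).1 e'), fun e' => hxi (σ.star.injective e')⟩
            · refine ⟨fun e' => hxs ((e _).1 e'), ?_, ?_⟩ <;> rw [hσ.star_star] <;> assumption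
          have hwcj := h.low_lt_high hσ hm hcl.1 hj
          have hwne := w.injective.ne hci.1
          have hwne' := w.injective.ne hci.2.1
          have hnc := hc.not_between c
          have hnd := hc.not_between (σ.star c)
          have hcr := h.cross_of_min hσ (x := c) (y := i) (hcl.2.trans hb.symm)
          have hle := h.le_of_le_star hcc
          have hnb := h.not_between c i
          have hl := hcl.1
          unfold Low at hl hi
          rw [min_eq_left hcc, max_eq_right hcc, lt_min_iff, lt_max_iff] at hcr
          simp only [Fin.lt_def, Fin.le_def, ne_eq, Fin.ext_iff] at *
          omega
        intro hbx hx
        refine ⟨main x hxi.1 hxi.2 hbx hx, main _ (fun e => hxi.2 ?_) (fun e => hxi.1 ?_)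
          (by rw [hσ.blk_star, hbx]) (hx.star hσ)⟩
        · rw [← e, hσ.star_star]
        · exact σ.star.injective e
      · exact fun _ hx => ⟨(h.low_lt_high hσ hm hi hx).le,
          (h.low_lt_high hσ hm hi (hx.star hσ)).le⟩
      · intro hbx hp hq
        have d := h.desc x (by rw [Fin.lt_def]; omega)
        have hnb := h.not_between_of_low hσ hm hpq hbx hp hq hi
        have := w.injective.ne hxi.1
        simp only [Fin.lt_def, ne_eq, Fin.ext_iff] at *
        omega
      · intro hbx hp hq
        have d := h.desc (σ.star x) (by rw [Fin.lt_def, hσ.star_star]; omega)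
        have hnb := h.not_between_of_low hσ hm hpq (a := σ.star x) (by rw [hσ.blk_star, hbx]) hp
          (by rwa [hσ.star_star]) hi
        have := w.injective.ne (a₁ := σ.star x) (a₂ := i) fun e => hxi.2 (by
          rw [← e, hσ.star_star])
        rw [hσ.star_star] at d hnb
        simp only [Fin.lt_def, ne_eq, Fin.ext_iff] at *
        omega
  have := Finset.sum_le_sum fun x (_ : x ∈ Finset.univ) => hle x
  rw [hsum, Finset.sum_add_distrib] at this
  simp at this
  omega

/-- Just after a high element `j` that opens its cycle, the value is one below the maximum. -/
lemma IsAtom.le_blockValue_high (h : IsAtom b₀ w σ) (hσ : σ.Valid) (hm : Cuts m b₀)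
    (hc : Ascent w i j) (hip : (i : ℕ) < p) (hpq : p ≤ q) (hqj : q ≤ j)
    (hi : σ.Low β p q i) (hj : σ.High β p q j) (hb : σ.blk j = β) (hs : σ.star j ≤ j) :
    m β ≤ (w j : ℕ) + 1 ∧ (w j : ℕ) + 1 ≤ m (β + 1) ∧
      σ.rank β p q ≤ blockValue m w β p q (w j + 1) + 1 := by
  have h₁ : m β ≤ (w j : ℕ) + 1 := by
    have := h.lt_iff hm j β
    omega
  have h₂ : (w j : ℕ) + 1 ≤ m (β + 1) := by
    have := h.lt_iff hm j (β + 1)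
    omega
  refine ⟨h₁, h₂, ?_⟩
  have hsum := h.sum_defect hσ hm β p q h₁ h₂
  have hle : ∀ x, defect σ w β p q (w j + 1) x ≤
      (if x = j then 1 else 0) + if x = σ.star j then 1 else 0 := by
    intro x
    by_cases hxi : x = j ∨ x = σ.star j
    · have hdi : defect σ w β p q (w j + 1) x = defect σ w β p q (w j + 1) j := by
        rcases hxi with rfl | rfl
        · rfl
        · unfold defect
          rw [hσ.star_star, add_comm]
      have key : defect σ w β p q (w j + 1) j ≤ if j = σ.star j then 2 else 1 := by
        have d := h.desc (σ.star j)
        rw [hσ.star_star] at d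
        unfold defect slack
        rw [hσ.blk_star, hσ.star_star]
        simp only [Fin.lt_def, Fin.le_def, Fin.ext_iff] at *
        split_ifs <;> omega
      rw [hdi]
      refine key.trans ?_
      rcases hxi with rfl | rfl
      · rw [if_pos rfl]
        split_ifs <;> omega
      · rw [if_pos (rfl : σ.star j = σ.star j)]
        simp only [eq_comm (a := j)]
        split_ifs <;> omega
    · push Not at hxi
      rw [if_neg hxi.1, if_neg hxi.2, defect_eq_zero hσ hpq]
      · rfl
      · exact fun _ hx => ⟨Nat.lt_succ_of_lt (h.low_lt_high hσ hm hx hj),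
          Nat.lt_succ_of_lt (h.low_lt_high hσ hm (hx.star hσ) hj)⟩
      · have main : ∀ x, x ≠ j → x ≠ σ.star j → σ.blk x = β → σ.High β p q x →
            (w j : ℕ) + 1 ≤ w x := by
          intro x hxi hxs hbx hx
          by_contra hcon
          obtain ⟨c, hcx, hcc, hwc⟩ := h.exists_max hσ x
          have hch : σ.High β p q c ∧ σ.blk c = β := by
            rcases hcx with rfl | rfl
            · exact ⟨hx, hbx⟩
            · exact ⟨hx.star hσ, by rw [hσ.blk_star, hbx]⟩
          have hci : c ≠ j ∧ σ.star c ≠ j ∧ σ.star c ≠ σ.star j := by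
            have e : ∀ y, σ.star x = y ↔ x = σ.star y := fun y =>
              ⟨fun e => by rw [← e, hσ.star_star], fun e => by rw [e, hσ.star_star]⟩
            rcases hcx with rfl | rfl
            · exact ⟨hxi, fun e' => hxs ((e _).1 e'), fun e' => hxi (σ.star.injective e')⟩
            · refine ⟨fun e' => hxs ((e _).1 e'), ?_, ?_⟩ <;> rw [hσ.star_star] <;> assumption
          have hwic := h.low_lt_high hσ hm hi hch.1
          have hwne := w.injective.ne hci.1
          have hwne' := w.injective.ne hci.2.1
          have hnc := hc.not_between c
          have hnd := hc.not_between (σ.star c)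
          have hcr := h.cross_of_min hσ (x := j) (y := c) (hb.trans hch.2.symm)
          have hle := h.le_of_le_star (a := σ.star c) (by rwa [hσ.star_star])
          have hnb := h.not_between (σ.star c) j
          have hl := hch.1
          unfold High at hl hj
          rw [min_eq_right hcc, max_eq_left hcc, min_lt_iff, max_lt_iff] at hcr
          rw [hσ.star_star] at hle hnb
          rw [hσ.blk_star] at hnb
          simp only [Fin.lt_def, Fin.le_def, ne_eq, Fin.ext_iff] at *
          omega
        intro hbx hx
        refine ⟨main x hxi.1 hxi.2 hbx hx, main _ (fun e => hxi.2 ?_) (fun e => hxi.1 ?_)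
          (by rw [hσ.blk_star, hbx]) (hx.star hσ)⟩
        · rw [← e, hσ.star_star]
        · exact σ.star.injective e
      · intro hbx hp hq
        have d := h.desc x (by rw [Fin.lt_def]; omega)
        have hnb := h.not_between_of_high hσ hm hpq hbx hp hq hj
        have := w.injective.ne (a₁ := σ.star x) (a₂ := j) fun e => hxi.2 (by
          rw [← e, hσ.star_star])
        have := w.injective.ne hxi.1
        simp only [Fin.lt_def, ne_eq, Fin.ext_iff] at *
        omega
      · intro hbx hp hq
        have d := h.desc (σ.star x) (by rw [Fin.lt_def, hσ.star_star]; omega)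
        have hnb := h.not_between_of_high hσ hm hpq (a := σ.star x) (by rw [hσ.blk_star, hbx]) hp
          (by rwa [hσ.star_star]) hj
        have := w.injective.ne (a₁ := σ.star x) (a₂ := j) fun e => hxi.2 (by
          rw [← e, hσ.star_star])
        have := w.injective.ne hxi.1
        rw [hσ.star_star] at d hnb
        simp only [Fin.lt_def, ne_eq, Fin.ext_iff] at *
        omega
  have := Finset.sum_le_sum fun x (_ : x ∈ Finset.univ) => hle x
  rw [hsum, Finset.sum_add_distrib] at this
  simp at this
  omega

end BlockState

/-! ### The rank function after exchanging two values -/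

namespace BlockState
variable {n : ℕ} {m : ℕ → ℕ} {b₀ : Fin n → ℕ} {w : Perm (Fin n)} {σ : BlockState n}
variable {i j : Fin n} {β p q : ℕ}

lemma Ascent.permCount_mul_swap (hc : Ascent w i j) (p k : ℕ) :
    permCount (w * swap i j) p k =
      permCount w p k - if ((i : ℕ) < p ∧ p ≤ j) ∧ (w i : ℕ) < k ∧ k ≤ w j then 1 else 0 := by
  classical
  have hlt := hc.lt
  have hmap := hc.map_lt
  rw [Fin.lt_def] at hlt hmap
  have key : permCount (w * swap i j) p k - permCount w p k =
      -if ((i : ℕ) < p ∧ p ≤ j) ∧ (w i : ℕ) < k ∧ k ≤ w j then 1 else 0 := by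
    rw [permCount, permCount, countBelow, countBelow,
      ← Finset.sum_sub_distrib, Fintype.sum_eq_add i j hc.lt.ne]
    · simp only [Perm.mul_apply, swap_apply_left, swap_apply_right]
      split_ifs <;> omega
    · rintro x ⟨hi, hj⟩
      rw [Perm.mul_apply, swap_apply_of_ne_of_ne hi hj, sub_self]
  rw [← neg_add_eq_sub, ← key, sub_add_cancel]

lemma Ascent.blockValue_mul_swap (hc : Ascent w i j) (β p q k : ℕ) :
    blockValue m (w * swap i j) β p q k = blockValue m w β p q k -
      (if ((i : ℕ) < p ∧ p ≤ j) ∧ (w i : ℕ) < k ∧ k ≤ w j then 1 else 0) -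
      if ((i : ℕ) < q ∧ q ≤ j) ∧ (w i : ℕ) < k ∧ k ≤ w j then 1 else 0 := by
  rw [blockValue, hc.permCount_mul_swap, hc.permCount_mul_swap, blockValue]
  ring

lemma MaxForm.rank_eq {ρ : BlockState n} (hρ : MaxForm m w ρ) {r : ℤ}
    (hle : ∀ k, m β ≤ k → k ≤ m (β + 1) → blockValue m w β p q k ≤ r)
    (hex : ∃ k, m β ≤ k ∧ k ≤ m (β + 1) ∧ r ≤ blockValue m w β p q k) :
    ρ.rank β p q = r := by
  obtain ⟨k, h₁, h₂, e⟩ := hρ.attained β p q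
  obtain ⟨k', h₁', h₂', e'⟩ := hex
  refine le_antisymm (e ▸ hle k h₁ h₂) (e'.trans (hρ.upper β p q k' h₁' h₂'))

open Classical in
/-- The rank function, for `p ≤ q`, of the state reached from an atom of `σ` by exchanging
the values `i < j`. -/
noncomputable def coverRank (σ : BlockState n) (i j : Fin n) (β p q : ℕ) : ℤ :=
  if σ.Low β p q i ∧ σ.High β p q j then
    if (i : ℕ) < p ∧ q ≤ j then
      if σ.blk i = β ∧ i ≤ σ.star i ∨ σ.blk j = β ∧ σ.star j ≤ j then σ.rank β p q - 1
      else σ.rank β p q - 2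
    else if (i : ℕ) < p ∧ p ≤ j ∨ (i : ℕ) < q ∧ q ≤ j then σ.rank β p q - 1
    else σ.rank β p q
  else σ.rank β p q

/-- Both elements of a cycle carry the same defect, so the sum of defects, twice the gap, is at
least 4. -/
lemma IsAtom.add_two_le (h : IsAtom b₀ w σ) (hσ : σ.Valid) (hm : Cuts m b₀) (hpq : p ≤ q)
    {k : ℕ} (h₁ : m β ≤ k) (h₂ : k ≤ m (β + 1)) {x : Fin n} (hx : x ≠ σ.star x)
    (hd : 2 ≤ defect σ w β p q k x) : blockValue m w β p q k + 2 ≤ σ.rank β p q := by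
  have hsum := h.sum_defect hσ hm β p q h₁ h₂
  have hd' : defect σ w β p q k (σ.star x) = defect σ w β p q k x := by
    unfold defect
    rw [hσ.star_star, add_comm]
  have := Finset.sum_le_sum_of_subset_of_nonneg (f := defect σ w β p q k)
    (Finset.subset_univ {x, σ.star x}) fun y _ _ => h.defect_nonneg hσ hpq k y
  rw [Finset.sum_pair hx, hsum, hd'] at this
  omega

/-- Here `i` is the larger end of its cycle, so its partner stands even later and both ends are
missing at the cut. -/
lemma IsAtom.add_two_le_before (h : IsAtom b₀ w σ) (hσ : σ.Valid) (hm : Cuts m b₀)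
    (hip : (i : ℕ) < p) (hpq : p ≤ q) (hi : σ.Low β p q i)
    (hs : ¬(σ.blk i = β ∧ i ≤ σ.star i)) {k : ℕ} (h₁ : m β ≤ k) (h₂ : k ≤ m (β + 1))
    (hk : k ≤ w i) : blockValue m w β p q k + 2 ≤ σ.rank β p q := by
  have hb : σ.blk i = β := by
    have := h.lt_iff hm i β
    unfold Low at hi
    omega
  have hlt : σ.star i < i := not_le.1 fun h' => hs ⟨hb, h'⟩
  refine h.add_two_le hσ hm hpq h₁ h₂ (x := i) hlt.ne' ?_
  have d := h.desc (σ.star i) (by rwa [hσ.star_star])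
  rw [hσ.star_star] at d
  unfold defect slack
  rw [hσ.blk_star, hσ.star_star]
  simp only [Fin.lt_def] at *
  split_ifs <;> omega

lemma IsAtom.add_two_le_after (h : IsAtom b₀ w σ) (hσ : σ.Valid) (hm : Cuts m b₀)
    (hpq : p ≤ q) (hqj : q ≤ j) (hj : σ.High β p q j)
    (hs : ¬(σ.blk j = β ∧ σ.star j ≤ j)) {k : ℕ} (h₁ : m β ≤ k) (h₂ : k ≤ m (β + 1))
    (hk : (w j : ℕ) < k) : blockValue m w β p q k + 2 ≤ σ.rank β p q := by
  have hb : σ.blk j = β := by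
    have := h.lt_iff hm j (β + 1)
    unfold High at hj
    omega
  have hlt : j < σ.star j := not_le.1 fun h' => hs ⟨hb, h'⟩
  refine h.add_two_le hσ hm hpq h₁ h₂ (x := j) hlt.ne ?_
  have d := h.desc j hlt
  unfold defect slack
  rw [hσ.blk_star, hσ.star_star]
  simp only [Fin.lt_def] at *
  split_ifs <;> omega

/-- The exchange lowers the value at each cut in the window `w i < k ≤ w j` by the number of
thresholds among `p, q` that separate `i` from `j`. If `i` is low and `j` high, all maximizing cuts
lie in the window; otherwise, if a threshold separates, one lies outside and the rank persists. When
both thresholds separate, the drop is 1 or 2 according to whether a cut outside comes within 1 of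
the maximum, which the cycles of `i` and `j` decide. -/
lemma IsAtom.rank_mul_swap (h : IsAtom b₀ w σ) (hσ : σ.Valid) (hm : Cuts m b₀)
    (hc : Ascent w i j) {ρ : BlockState n} (hρ : MaxForm m (w * swap i j) ρ) (hpq : p ≤ q) :
    ρ.rank β p q = coverRank σ i j β p q := by
  have hle : ∀ k, m β ≤ k → k ≤ m (β + 1) → blockValue m w β p q k ≤ σ.rank β p q :=
    fun k h₁ h₂ => h.blockValue_le hσ hm hpq h₁ h₂
  obtain ⟨k₀, hk₁, hk₂, hk, -⟩ := h.exists_first hσ hm (β := β) hpq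
  have hlt := hc.map_lt
  rw [Fin.lt_def] at hlt
  by_cases hd : (i : ℕ) < p ∧ p ≤ j ∨ (i : ℕ) < q ∧ q ≤ j
  · by_cases hij : σ.Low β p q i ∧ σ.High β p q j
    · have hin : ∀ k, m β ≤ k → k ≤ m (β + 1) → ¬((w i : ℕ) < k ∧ k ≤ w j) →
          blockValue m w β p q k + 1 ≤ σ.rank β p q := by
        intro k h₁ h₂ hout
        refine Int.add_one_le_iff.2 (lt_of_le_of_ne (hle k h₁ h₂) fun e => hout ?_)
        obtain ⟨hl, hh⟩ := h.of_blockValue_eq hσ hm hpq h₁ h₂ e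
        exact ⟨hl i hij.1, hh j hij.2⟩
      have hk₀ := h.of_blockValue_eq hσ hm hpq hk₁ hk₂ hk
      have hk₀i := hk₀.1 i hij.1
      have hk₀j := hk₀.2 j hij.2
      rw [coverRank, if_pos hij]
      split_ifs with hb hs
      · refine hρ.rank_eq (fun k h₁ h₂ => ?_) ?_
        · have h₃ := hin k h₁ h₂
          have h₄ := hle k h₁ h₂
          rw [hc.blockValue_mul_swap]
          split_ifs <;> omega
        -- The cut just before `i`, respectively just after `j`, is outside the window and only one
        -- below the maximum.
        · rcases hs with ⟨hs, hs'⟩ | ⟨hs, hs'⟩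
          · obtain ⟨h₁, h₂, h₃⟩ := h.le_blockValue_low hσ hm hc hb.1 hpq hb.2 hij.1 hij.2 hs hs'
            refine ⟨w i, h₁, h₂, ?_⟩
            rw [hc.blockValue_mul_swap, if_neg (by omega), if_neg (by omega)]
            omega
          · obtain ⟨h₁, h₂, h₃⟩ := h.le_blockValue_high hσ hm hc hb.1 hpq hb.2 hij.1 hij.2 hs hs'
            refine ⟨w j + 1, h₁, h₂, ?_⟩
            rw [hc.blockValue_mul_swap, if_neg (by omega), if_neg (by omega)]
            omega
      -- Now cuts outside the window are at least 2 below the maximum, and those inside lose 2 by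
      -- the exchange.
      · push Not at hs
        refine hρ.rank_eq (fun k h₁ h₂ => ?_) ⟨k₀, hk₁, hk₂, ?_⟩
        · have h₄ := hle k h₁ h₂
          rw [hc.blockValue_mul_swap]
          by_cases hk : (w i : ℕ) < k ∧ k ≤ w j
          · rw [if_pos (by omega), if_pos (by omega)]
            omega
          · have : blockValue m w β p q k + 2 ≤ σ.rank β p q := by
              rcases le_or_gt k (w i) with h₅ | h₅
              · exact h.add_two_le_before hσ hm hb.1 hpq hij.1
                  (fun h' => not_lt.2 h'.2 (hs.1 h'.1)) h₁ h₂ h₅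
              · exact h.add_two_le_after hσ hm hpq hb.2 hij.2
                  (fun h' => not_lt.2 h'.2 (hs.2 h'.1)) h₁ h₂ (by omega)
            split_ifs <;> omega
        · rw [hc.blockValue_mul_swap]
          split_ifs <;> omega
      · refine hρ.rank_eq (fun k h₁ h₂ => ?_) ⟨k₀, hk₁, hk₂, ?_⟩
        · have h₃ := hin k h₁ h₂
          have h₄ := hle k h₁ h₂
          rw [hc.blockValue_mul_swap]
          split_ifs <;> omega
        · rw [hc.blockValue_mul_swap]
          split_ifs <;> omega
    · obtain ⟨k, h₁, h₂, h₃, h₄⟩ := h.exists_outside hσ hm hc hpq hd hij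
      rw [coverRank, if_neg hij]
      refine hρ.rank_eq (fun k h₁ h₂ => ?_) ⟨k, h₁, h₂, ?_⟩
      · have := hle k h₁ h₂
        rw [hc.blockValue_mul_swap]
        split_ifs <;> omega
      · rw [hc.blockValue_mul_swap, if_neg (by omega), if_neg (by omega)]
        omega
  · have e : coverRank σ i j β p q = σ.rank β p q := by
      rw [coverRank]
      split_ifs
      · omega
      · omega
      · rfl
      · rfl
    rw [e]
    refine hρ.rank_eq (fun k h₁ h₂ => ?_) ⟨k₀, hk₁, hk₂, ?_⟩
    · have := hle k h₁ h₂
      rw [hc.blockValue_mul_swap]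
      split_ifs <;> omega
    · rw [hc.blockValue_mul_swap, if_neg (by omega), if_neg (by omega)]
      omega

/-- Exchanging the same two values in two atoms of a state that are both covered leads to the
same state. -/
lemma IsAtom.mul_swap_unique (hσ : σ.Valid) (hm : Cuts m b₀) {v : Perm (Fin n)}
    (hw : IsAtom b₀ w σ) (hv : IsAtom b₀ v σ) (hcw : Ascent w i j) (hcv : Ascent v i j)
    {ρ τ : BlockState n} (hρ : MaxForm m (w * swap i j) ρ) (hτ : MaxForm m (v * swap i j) τ)
    (hρv : ρ.Valid) (hτv : τ.Valid) : ρ = τ := by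
  refine ext_rank fun β p q => ?_
  -- The formula needs `p ≤ q`; ranks of valid states are symmetric.
  rcases le_total p q with hpq | hpq
  · rw [hw.rank_mul_swap hσ hm hcw hρ hpq, hv.rank_mul_swap hσ hm hcv hτ hpq]
  · rw [hρv.rank_comm, hτv.rank_comm, hw.rank_mul_swap hσ hm hcw hρ hpq,
      hv.rank_mul_swap hσ hm hcv hτ hpq]

end BlockState

/-! ## The state of a `μ`-involution -/

section
variable {n : ℕ}

lemma invCount_inv (w : Perm (Fin n)) : invCount w⁻¹ = invCount w := by
  refine Finset.card_bij (fun z _ => (w⁻¹ z.2, w⁻¹ z.1)) ?_ ?_ ?_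
  · intro z hz
    obtain ⟨h₁, h₂⟩ := mem_invSet.1 hz
    refine mem_invSet.2 ⟨h₂, ?_⟩
    simpa using h₁
  · rintro ⟨x, y⟩ _ ⟨x', y'⟩ _ h
    simpa [and_comm] using h
  · rintro ⟨x, y⟩ hz
    obtain ⟨h₁, h₂⟩ := mem_invSet.1 hz
    refine ⟨(w y, w x), mem_invSet.2 ⟨h₂, ?_⟩, ?_⟩ <;> simp [h₁]

lemma permLength_lt_mul_adjSwap (w : Perm (Fin n)) (i : Fin (n - 1)) :
    permLength w < permLength (w * adjSwap i) ↔ w (lowVal i) < w (highVal i) := by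
  rw [permLength_eq, permLength_eq]
  rcases lt_or_gt_of_ne (w.injective.ne (lowVal_ne_highVal i)) with h | h
  · have := invCount_mul_adjSwap h
    exact iff_of_true (by omega) h
  · have := invCount_mul_adjSwap_of_gt h
    exact iff_of_false (by omega) h.not_gt

lemma permLength_lt_adjSwap_mul (w : Perm (Fin n)) (i : Fin (n - 1)) :
    permLength w < permLength (adjSwap i * w) ↔ w.symm (lowVal i) < w.symm (highVal i) := by
  have h := permLength_lt_mul_adjSwap w⁻¹ i
  rw [permLength_eq, permLength_eq, ← invCount_inv (_ * _), invCount_inv w, mul_inv_rev, inv_inv,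
    adjSwap_inv, ← permLength_eq, ← permLength_eq] at h
  exact h

lemma heckeRight_eq (w : Perm (Fin n)) (i : Fin (n - 1)) :
    heckeRight w i = if w (lowVal i) < w (highVal i) then w * adjSwap i else w := by
  classical
  rw [heckeRight, simpleTransp_eq]
  simp only [permLength_lt_mul_adjSwap]

lemma heckeLeft_eq (w : Perm (Fin n)) (i : Fin (n - 1)) :
    heckeLeft i w = if w.symm (lowVal i) < w.symm (highVal i) then adjSwap i * w else w := by
  classical
  rw [heckeLeft, simpleTransp_eq]
  simp only [permLength_lt_adjSwap_mul]

lemma val_standardize {k : ℕ} (Q : Fin k → Fin n) (j : Fin k) :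
    (standardize Q j : ℕ) = (Finset.univ.filter fun l => Q l < Q j).card := rfl

lemma standardize_lt_iff {k : ℕ} {Q : Fin k → Fin n} {x y : Fin k} :
    standardize Q x < standardize Q y ↔ Q x < Q y := by
  have hle : ∀ {x y : Fin k}, Q x ≤ Q y → standardize Q x ≤ standardize Q y := by
    intro x y h
    rw [Fin.le_def, val_standardize, val_standardize]
    refine Finset.card_le_card fun l hl => ?_
    simp only [Finset.mem_filter, Finset.mem_univ, true_and] at hl ⊢
    exact hl.trans_le h
  refine ⟨fun h => not_le.1 fun h' => (hle h').not_gt h, fun h => ?_⟩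
  rw [Fin.lt_def, val_standardize, val_standardize]
  refine Finset.card_lt_card (Finset.ssubset_iff_of_subset ?_ |>.2 ⟨x, ?_, ?_⟩)
  · intro l hl
    simp only [Finset.mem_filter, Finset.mem_univ, true_and] at hl ⊢
    exact hl.trans h
  · simpa using h
  · simp

lemma standardize_injective {k : ℕ} {Q : Fin k → Fin n} (hQ : Function.Injective Q) :
    Function.Injective (standardize Q) := by
  intro x y h
  apply hQ
  refine le_antisymm ?_ ?_ <;> rw [← not_lt, ← standardize_lt_iff, h] <;> exact lt_irrefl _

/-! ### Relative positions within blocks -/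

variable (μ : Composition n) (π : Perm (Fin n))

lemma block_injective (b : Fin μ.length) : Function.Injective (block μ π b) :=
  π.injective.comp (μ.embedding b).injective

lemma index_relPosition (x : Fin n) : μ.index (relPosition μ π x) = blockOf μ π x :=
  μ.index_embedding _ _

lemma relPosition_apply_embedding (b : Fin μ.length) (l : Fin (μ.blocksFun b)) :
    relPosition μ π (π (μ.embedding b l)) = μ.embedding b (standardize (block μ π b) l) := by
  have key : ∀ p, μ.embedding b l = p →
      μ.embedding (μ.index p) (standardize (block μ π (μ.index p)) (μ.invEmbedding p)) =
        μ.embedding b (standardize (block μ π b) l) := by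
    intro p hp
    have hb : b = μ.index p := by rw [← hp, μ.index_embedding]
    subst hb
    have : l = μ.invEmbedding p :=
      (μ.embedding _).injective (hp.trans (μ.embedding_comp_inv p).symm)
    rw [this]
  have := key (π.symm (π (μ.embedding b l))) (by simp)
  exact this

lemma exists_eq_apply_embedding (x : Fin n) : ∃ l : Fin (μ.blocksFun (blockOf μ π x)),
    x = π (μ.embedding (blockOf μ π x) l) :=
  ⟨μ.invEmbedding (π.symm x), by
    have := μ.embedding_comp_inv (π.symm x)
    exact (π.symm_apply_eq.1 this.symm)⟩

lemma relPosition_injective : Function.Injective (relPosition μ π) := by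
  intro x y h
  have hb := congrArg μ.index h
  rw [index_relPosition, index_relPosition] at hb
  obtain ⟨l, hl⟩ := exists_eq_apply_embedding μ π x
  obtain ⟨l', hl'⟩ := exists_eq_apply_embedding μ π y
  generalize blockOf μ π x = b at *
  generalize blockOf μ π y = b' at *
  subst hb
  rw [hl, hl', relPosition_apply_embedding, relPosition_apply_embedding] at h
  rw [hl, hl', standardize_injective (block_injective μ π _) ((μ.embedding _).injective h)]

/-- The right-hand side depends on `π` only through the colouring of values by blocks; this gives
`relPosition_congr`. -/
lemma val_relPosition (x : Fin n) : (relPosition μ π x : ℕ) = μ.sizeUpTo (blockOf μ π x) +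
    (Finset.univ.filter fun y => blockOf μ π y = blockOf μ π x ∧ y < x).card := by
  obtain ⟨l, hl⟩ := exists_eq_apply_embedding μ π x
  generalize hb : blockOf μ π x = b at l hl
  subst hl
  rw [relPosition_apply_embedding, μ.coe_embedding]
  congr 1
  rw [val_standardize]
  refine Finset.card_bij (fun l' _ => π (μ.embedding b l')) ?_ ?_ ?_
  · intro l' hl'
    refine Finset.mem_filter.2 ⟨Finset.mem_univ _, ?_, (Finset.mem_filter.1 hl').2⟩
    rw [blockOf, Equiv.symm_apply_apply, μ.index_embedding]
  · intro l₁ _ l₂ _ h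
    exact block_injective μ π b h
  · intro y hy
    simp only [Finset.mem_filter, Finset.mem_univ, true_and] at hy
    obtain ⟨l', hl'⟩ := exists_eq_apply_embedding μ π y
    generalize blockOf μ π y = b' at *
    obtain ⟨rfl, hlt⟩ := hy
    rw [hl'] at hlt
    exact ⟨l', Finset.mem_filter.2 ⟨Finset.mem_univ _, hlt⟩, hl'.symm⟩

/-- On positions, the standardized blocks together form the map `p ↦ relPosition μ π (π p)`. -/
lemma isMuInvolution_iff :
    IsMuInvolution μ π ↔ ∀ x, relPosition μ π (π (relPosition μ π x)) = π.symm x := by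
  constructor
  · intro h x
    obtain ⟨l, hl⟩ := exists_eq_apply_embedding μ π x
    generalize blockOf μ π x = b at *
    rw [hl, relPosition_apply_embedding, relPosition_apply_embedding, h b, Equiv.symm_apply_apply]
  · intro h b l
    have := h (π (μ.embedding b l))
    rw [relPosition_apply_embedding, relPosition_apply_embedding, Equiv.symm_apply_apply] at this
    exact (μ.embedding b).injective this

/-- The block index of each value, with the partner of each value within its block. -/
noncomputable def muState : BlockState n where
  blk x := blockOf μ π x
  star := Equiv.ofBijective (fun x => π (relPosition μ π x))
    (Finite.injective_iff_bijective.1 (π.injective.comp (relPosition_injective μ π)))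

@[simp] lemma muState_blk (x : Fin n) : (muState μ π).blk x = blockOf μ π x := rfl

@[simp] lemma muState_star (x : Fin n) : (muState μ π).star x = π (relPosition μ π x) := rfl

lemma blockOf_apply_relPosition (x : Fin n) :
    blockOf μ π (π (relPosition μ π x)) = blockOf μ π x := by
  rw [blockOf, Equiv.symm_apply_apply, index_relPosition]

variable {μ π}

lemma isMuInvolution_iff_valid : IsMuInvolution μ π ↔ (muState μ π).Valid := by
  rw [isMuInvolution_iff]
  constructor
  · intro h
    refine ⟨fun x => ?_, fun x => ?_⟩
    · rw [muState_star, muState_star, h, Equiv.apply_symm_apply]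
    · rw [muState_blk, muState_blk, muState_star, blockOf_apply_relPosition]
  · intro h x
    rw [Equiv.eq_symm_apply]
    exact h.star_star x

lemma relPosition_congr {π' : Perm (Fin n)} (h : ∀ x, blockOf μ π' x = blockOf μ π x) :
    relPosition μ π' = relPosition μ π := by
  funext x
  apply Fin.ext
  rw [val_relPosition, val_relPosition]
  simp only [h]

lemma muState_injective : Function.Injective (muState μ) := by
  intro π π' h
  have hb : ∀ x, blockOf μ π' x = blockOf μ π x := fun x =>
    Fin.ext (congrArg (fun σ => σ.blk x) h.symm)
  ext1 p
  obtain ⟨x, rfl⟩ := (Finite.injective_iff_surjective.1 (relPosition_injective μ π)) p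
  have := congrArg (fun σ => σ.star x) h
  simp only [muState_star, relPosition_congr hb] at this
  exact this

lemma relPosition_lt {x y : Fin n} (hb : blockOf μ π x = blockOf μ π y) (h : x < y) :
    relPosition μ π x < relPosition μ π y := by
  rw [Fin.lt_def, val_relPosition, val_relPosition, hb]
  refine Nat.add_lt_add_left (Finset.card_lt_card ?_) _
  refine Finset.ssubset_iff_of_subset ?_ |>.2 ⟨x, ?_, ?_⟩
  · intro z hz
    simp only [Finset.mem_filter, Finset.mem_univ, true_and] at hz ⊢
    exact ⟨hz.1, hz.2.trans h⟩
  · simpa [hb] using h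
  · simp

lemma relPosition_highVal {i : Fin (n - 1)}
    (hb : blockOf μ π (lowVal i) = blockOf μ π (highVal i)) :
    (relPosition μ π (highVal i) : ℕ) = relPosition μ π (lowVal i) + 1 := by
  classical
  rw [val_relPosition, val_relPosition, hb, add_assoc]
  congr 1
  rw [← Finset.card_insert_of_notMem (a := lowVal i) (by simp)]
  congr 1
  ext y
  simp only [Finset.mem_insert, Finset.mem_filter, Finset.mem_univ, true_and, Fin.lt_def,
    val_highVal, val_lowVal, Fin.ext_iff (a := y)]
  constructor
  · rintro ⟨h₁, h₂⟩
    by_cases h : (y : ℕ) = i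
    · exact Or.inl h
    · exact Or.inr ⟨h₁, by omega⟩
  · rintro (h | h)
    · have : y = lowVal i := Fin.ext h
      exact ⟨by rw [this, hb], by omega⟩
    · exact ⟨h.1, by omega⟩

lemma index_monotone {p q : Fin n} (h : p ≤ q) : μ.index p ≤ μ.index q := by
  by_contra! hlt
  have h₁ := μ.sizeUpTo_index_le p
  have h₂ := μ.lt_sizeUpTo_index_succ q
  have h₃ := μ.monotone_sizeUpTo (show (μ.index q : ℕ) + 1 ≤ μ.index p from hlt)
  rw [Fin.le_def] at h
  simp only [Fin.val_succ] at h₂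
  omega

variable (μ) in
lemma cuts_sizeUpTo : BlockState.Cuts μ.sizeUpTo (fun p => (μ.index p : ℕ)) where
  mono := μ.monotone_sizeUpTo
  le := μ.sizeUpTo_le
  lt_iff p β := by
    constructor
    · intro h
      exact (μ.lt_sizeUpTo_index_succ p).trans_le (μ.monotone_sizeUpTo (by simpa using h))
    · intro h
      by_contra! hle
      exact absurd (h.trans_le (μ.monotone_sizeUpTo hle)) (μ.sizeUpTo_index_le p).not_gt

variable (μ) in
lemma muState_one : muState μ 1 = BlockState.base (fun p => (μ.index p : ℕ)) := by
  ext x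
  · rfl
  · have hst : ∀ (b : Fin μ.length) (l : Fin (μ.blocksFun b)),
        standardize (block μ 1 b) l = l := fun b l => by
      apply Fin.ext
      rw [val_standardize]
      simp only [block, Perm.one_apply, OrderEmbedding.lt_iff_lt]
      rw [Finset.filter_gt_eq_Iio, Fin.card_Iio]
    obtain ⟨l, hl⟩ := exists_eq_apply_embedding μ 1 x
    have := relPosition_apply_embedding μ 1 _ l
    rw [← hl, hst] at this
    rw [muState_star, this, ← hl]
    rfl

/-- The position of a value is the relative position of its partner, so positions are ordered by the
key (block, partner). -/
lemma symm_lt_symm_iff_asc (h : IsMuInvolution μ π) (i : Fin (n - 1)) :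
    π.symm (lowVal i) < π.symm (highVal i) ↔ (muState μ π).Asc i := by
  have hs := (isMuInvolution_iff μ π).1 h
  have himp : ∀ x y : Fin n, (blockOf μ π x < blockOf μ π y ∨ blockOf μ π x = blockOf μ π y ∧
      π (relPosition μ π x) < π (relPosition μ π y)) → π.symm x < π.symm y := by
    rintro x y (hlt | ⟨he, hlt⟩)
    · exact not_le.1 fun hle => (index_monotone (μ := μ) hle).not_gt hlt
    · rw [← hs, ← hs]
      exact relPosition_lt (by rw [blockOf_apply_relPosition, blockOf_apply_relPosition, he]) hlt
  constructor
  · intro hlt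
    by_contra hn
    rcases BlockState.desc_of_not_asc hn with hd | ⟨he, hd⟩
    · exact lt_asymm hlt (himp _ _ (Or.inl hd))
    · exact lt_asymm hlt (himp _ _ (Or.inr ⟨Fin.ext he.symm, hd⟩))
  · rintro (hd | ⟨he, hd⟩)
    · exact himp _ _ (Or.inl hd)
    · exact himp _ _ (Or.inr ⟨Fin.ext he, hd⟩)

lemma muState_adjSwap_mul_of_ne {i : Fin (n - 1)}
    (hb : blockOf μ π (lowVal i) ≠ blockOf μ π (highVal i)) :
    muState μ (adjSwap i * π) = (muState μ π).conjSwap i := by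
  classical
  have hblk : ∀ x, blockOf μ (adjSwap i * π) x = blockOf μ π (adjSwap i x) := fun x => rfl
  have hrel : ∀ x, relPosition μ (adjSwap i * π) x = relPosition μ π (adjSwap i x) := by
    intro x
    apply Fin.ext
    rw [val_relPosition, val_relPosition]
    simp only [hblk]
    congr 1
    refine Finset.card_bij (fun y _ => adjSwap i y) ?_ ?_ ?_
    · intro y hy
      simp only [Finset.mem_filter, Finset.mem_univ, true_and] at hy ⊢
      refine ⟨hy.1, adjSwap_lt_adjSwap hy.2 ?_⟩
      rintro ⟨rfl, rfl⟩
      simp only [adjSwap_lowVal, adjSwap_highVal] at hy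
      exact hb hy.1.symm
    · intro y _ z _ h
      exact (adjSwap i).injective h
    · intro y hy
      simp only [Finset.mem_filter, Finset.mem_univ, true_and] at hy
      refine ⟨adjSwap i y, ?_, adjSwap_apply_apply i y⟩
      have := adjSwap_lt_adjSwap (i := i) hy.2 (by
        rintro ⟨h₁, h₂⟩
        rw [h₁, h₂] at hy
        exact hb hy.1)
      rw [adjSwap_apply_apply] at this
      simpa [hy.1] using this
  ext x
  · rfl
  · rw [muState_star, hrel]
    rfl

lemma muState_adjSwap_mul_of_eq {i : Fin (n - 1)}
    (hb : blockOf μ π (lowVal i) = blockOf μ π (highVal i)) :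
    muState μ (adjSwap i * π) = ⟨fun x => (muState μ π).blk (adjSwap i x),
      adjSwap i * (muState μ π).star⟩ := by
  have hblk : ∀ x, blockOf μ (adjSwap i * π) x = blockOf μ π x := fun x => by
    change blockOf μ π (adjSwap i x) = _
    rcases adjSwap_cases i x with ⟨h, e⟩ | ⟨h, e⟩ | ⟨_, _, e⟩ <;> simp [*]
  ext x
  · rfl
  · rw [muState_star, relPosition_congr hblk]
    rfl

/-- `relPosition` carries `s_i` to `s_k`, so the right factor `s_k` becomes right multiplication of
`star` by `s_i`. -/
lemma muState_adjSwap_mul_mul {i k : Fin (n - 1)}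
    (hb : blockOf μ π (lowVal i) = blockOf μ π (highVal i))
    (hlo : relPosition μ π (lowVal i) = lowVal k) (hhi : relPosition μ π (highVal i) = highVal k) :
    muState μ (adjSwap i * π * adjSwap k) = (muState μ π).conjSwap i := by
  have hk : ∀ p, μ.index (adjSwap k p) = μ.index p := by
    have : μ.index (lowVal k) = μ.index (highVal k) := by
      rw [← hlo, ← hhi, index_relPosition, index_relPosition, hb]
    intro p
    rcases adjSwap_cases k p with ⟨h, e⟩ | ⟨h, e⟩ | ⟨_, _, e⟩ <;> simp [*]
  have hblk' : ∀ x, blockOf μ (adjSwap i * π * adjSwap k) x = blockOf μ π (adjSwap i x) :=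
    fun x => hk _
  have hblk : ∀ x, blockOf μ (adjSwap i * π * adjSwap k) x = blockOf μ π x := fun x => by
    rw [hblk']
    rcases adjSwap_cases i x with ⟨h, e⟩ | ⟨h, e⟩ | ⟨_, _, e⟩ <;> simp [*]
  have hrel : ∀ x, adjSwap k (relPosition μ π x) = relPosition μ π (adjSwap i x) := by
    intro x
    rcases adjSwap_cases i x with ⟨h, e⟩ | ⟨h, e⟩ | ⟨h₀, h₁, e⟩
    · rw [e, h, hlo, hhi, adjSwap_lowVal]
    · rw [e, h, hlo, hhi, adjSwap_highVal]
    · rw [e]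
      apply adjSwap_of_ne
      · rw [← hlo]
        exact (relPosition_injective μ π).ne h₀
      · rw [← hhi]
        exact (relPosition_injective μ π).ne h₁
  ext x
  · exact congrArg Fin.val (hblk' x)
  · rw [muState_star, relPosition_congr hblk]
    simp only [Perm.mul_apply, hrel]
    rfl

lemma muState_muAct (h : IsMuInvolution μ π) (i : Fin (n - 1)) :
    muState μ (muAct μ π i) = (muState μ π).act i := by
  classical
  have hL := heckeLeft_eq π i
  simp only [symm_lt_symm_iff_asc h] at hL
  have hV := isMuInvolution_iff_valid.1 h
  have hdef : muAct μ π i = if blockOf μ π (lowVal i) = blockOf μ π (highVal i) then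
    heckeRight (heckeLeft i π) (relPosition μ π (lowVal i)) else heckeLeft i π := rfl
  rw [hdef, hL]
  split_ifs with hb ha ha
  · have hrel := relPosition_highVal hb
    let k : Fin (n - 1) := ⟨relPosition μ π (lowVal i), by omega⟩
    have hlo : relPosition μ π (lowVal i) = lowVal k := rfl
    have hhi : relPosition μ π (highVal i) = highVal k := Fin.ext hrel
    have hlt : (muState μ π).star (lowVal i) < (muState μ π).star (highVal i) := by
      rcases ha with ha | ha
      · exact absurd hb (ne_of_lt ha)
      · exact ha.2
    have e₁ : π (lowVal k) = (muState μ π).star (lowVal i) := by rw [← hlo]; rfl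
    have e₂ : π (highVal k) = (muState μ π).star (highVal i) := by rw [← hhi]; rfl
    have hR := heckeRight_eq (adjSwap i * π) k
    simp only [Perm.mul_apply, e₁, e₂] at hR
    rw [show ((relPosition μ π (lowVal i) : Fin n) : ℕ) = k from rfl, hR, BlockState.act,
      if_pos ha]
    by_cases hf : (muState μ π).star (lowVal i) = lowVal i ∧
        (muState μ π).star (highVal i) = highVal i
    -- Both values are fixed by `star`: the left factor has already created a descent at `k, k+1`,
    -- so the right Hecke factor is trivial.
    · rw [if_neg (by rw [hf.1, hf.2]; simpa using (lowVal_lt_highVal i).le),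
        if_pos ⟨hf.1, hf.2, congrArg Fin.val hb⟩, muState_adjSwap_mul_of_eq hb,
        BlockState.rowSwap]
      congr 1
      exact Equiv.ext fun x => (BlockState.Valid.comm_of_fixed hf.1 hf.2 x).symm
    · rw [if_pos (adjSwap_lt_adjSwap hlt hf), if_neg fun h' => hf ⟨h'.1, h'.2.1⟩,
        muState_adjSwap_mul_mul hb hlo hhi]
  · have hrel := relPosition_highVal hb
    let k : Fin (n - 1) := ⟨relPosition μ π (lowVal i), by omega⟩
    have hlo : relPosition μ π (lowVal i) = lowVal k := rfl
    have hhi : relPosition μ π (highVal i) = highVal k := Fin.ext hrel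
    have hgt : π (highVal k) < π (lowVal k) := by
      rw [← hlo, ← hhi]
      rcases BlockState.desc_of_not_asc ha with hd | ⟨_, hd⟩
      · exact absurd hb.symm (ne_of_lt hd)
      · exact hd
    rw [show ((relPosition μ π (lowVal i) : Fin n) : ℕ) = k from rfl, heckeRight_eq,
      if_neg hgt.not_gt, BlockState.act_of_not_asc ha]
  · rw [muState_adjSwap_mul_of_ne hb, BlockState.act, if_pos ha, if_neg]
    exact fun h' => hb (Fin.ext h'.2.2)
  · rw [BlockState.act_of_not_asc ha]

lemma muWordProd_append_singleton (a : List (Fin (n - 1))) (i : Fin (n - 1)) :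
    muWordProd μ (a ++ [i]) = muAct μ (muWordProd μ a) i := by
  simp [muWordProd]

variable (μ) in
lemma muState_muWordProd (a : List (Fin (n - 1))) :
    muState μ (muWordProd μ a) = BlockState.run (fun p => (μ.index p : ℕ)) a := by
  induction a using List.reverseRecOn with
  | nil => exact muState_one μ
  | append_singleton a i ih =>
    rw [muWordProd_append_singleton, BlockState.run_append_singleton, ← ih]
    refine muState_muAct (isMuInvolution_iff_valid.2 ?_) i
    rw [ih]
    exact BlockState.run_valid _ _

variable (μ) in
lemma isMuInvolution_muWordProd (a : List (Fin (n - 1))) : IsMuInvolution μ (muWordProd μ a) := by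
  rw [isMuInvolution_iff_valid, muState_muWordProd]
  exact BlockState.run_valid _ _

lemma isReducedMuWord_iff {a : List (Fin (n - 1))} {π : MuInvolution μ} :
    IsReducedMuWord μ a π ↔
      BlockState.Strict (fun p => (μ.index p : ℕ)) a (muState μ π) := by
  rw [BlockState.strict_iff (cuts_sizeUpTo μ).monotone]
  simp only [← muState_muWordProd, muState_injective.eq_iff]
  rfl

end

/-! ### Covers between atoms, and the theorem -/

section
open BlockState
variable {n : ℕ} {μ : Composition n}

lemma mem_muAtoms_iff {π : MuInvolution μ} {w : Perm (Fin n)} :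
    w ∈ muAtoms μ π ↔
      ∃ a, Strict (fun p => (μ.index p : ℕ)) a (muState μ π) ∧ wordProd a = w := by
  constructor
  · rintro ⟨a, ha, hπ⟩
    exact ⟨a, isReducedMuWord_iff.1 hπ, ha.1⟩
  · rintro ⟨a, ha, rfl⟩
    exact ⟨a, isReducedWord_iff.2 ⟨rfl, (ha.isAtom (cuts_sizeUpTo μ)).1.symm⟩,
      isReducedMuWord_iff.2 ha⟩

lemma isAtom_of_mem_muAtoms {π : MuInvolution μ} {w : Perm (Fin n)} (h : w ∈ muAtoms μ π) :
    MaxForm μ.sizeUpTo w (muState μ π) ∧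
      IsAtom (fun p => (μ.index p : ℕ)) w (muState μ π) := by
  obtain ⟨a, ha, rfl⟩ := mem_muAtoms_iff.1 h
  exact (ha.isAtom (cuts_sizeUpTo μ)).2

lemma invCount_eq_of_mem_muAtoms {π : MuInvolution μ} {v w : Perm (Fin n)} (hv : v ∈ muAtoms μ π)
    (hw : w ∈ muAtoms μ π) : invCount v = invCount w := by
  obtain ⟨a, ha, rfl⟩ := mem_muAtoms_iff.1 hv
  obtain ⟨b, hb, rfl⟩ := mem_muAtoms_iff.1 hw
  rw [(ha.isAtom (cuts_sizeUpTo μ)).1, (hb.isAtom (cuts_sizeUpTo μ)).1,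
    ha.length_eq (cuts_sizeUpTo μ).monotone hb]

/-- Two covers of atoms of `π` by the same transposition lead to the same state. -/
lemma run_eq_of_cover {π τ : MuInvolution μ} {v w : Perm (Fin n)} {i j : Fin n}
    (hv : v ∈ muAtoms μ π) (hw : w ∈ muAtoms μ π) (hcv : BruhatCover v (v * swap i j))
    (hcw : BruhatCover w (w * swap i j)) (hτ : v * swap i j ∈ muAtoms μ τ)
    {a : List (Fin (n - 1))} (ha : IsReducedWord a (w * swap i j)) :
    run (fun p => (μ.index p : ℕ)) a = muState μ τ := by
  wlog hij : i < j generalizing i j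
  · rcases (not_lt.1 hij).lt_or_eq with h | rfl
    · rw [swap_comm] at hcv hcw hτ ha
      exact this hcv hcw hτ ha h
    · have := hcv.2
      rw [swap_self, ← Perm.one_def, mul_one] at this
      omega
  obtain ⟨haw, hal⟩ := isReducedWord_iff.1 ha
  have hred := maxForm_of_reduced (cuts_sizeUpTo μ) a (by rw [haw, hal])
  rw [haw] at hred
  have h₁ := hcw.ascent hij
  have h₂ := hcv.ascent hij
  exact (isAtom_of_mem_muAtoms hw).2.mul_swap_unique (isMuInvolution_iff_valid.1 π.2)
    (cuts_sizeUpTo μ) (isAtom_of_mem_muAtoms hv).2 ⟨hij, h₁.1, h₁.2⟩ ⟨hij, h₂.1, h₂.2⟩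
    hred (isAtom_of_mem_muAtoms hτ).1 (run_valid _ _) (isMuInvolution_iff_valid.1 τ.2)

/-- If `v` and `v * t` are atoms of `π` and `τ`, then covers by `t` send atoms of `π` to
atoms of `τ`. -/
lemma mul_swap_mem_muAtoms {π τ : MuInvolution μ} {v w : Perm (Fin n)} {i j : Fin n}
    (hv : v ∈ muAtoms μ π) (hw : w ∈ muAtoms μ π) (hcv : BruhatCover v (v * swap i j))
    (hcw : BruhatCover w (w * swap i j)) (hτ : v * swap i j ∈ muAtoms μ τ) :
    w * swap i j ∈ muAtoms μ τ := by
  obtain ⟨a, haw, hal⟩ := exists_word (w * swap i j)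
  have ha : IsReducedWord a (w * swap i j) := isReducedWord_iff.2 ⟨haw, hal⟩
  have hrun := run_eq_of_cover hv hw hcv hcw hτ ha
  obtain ⟨c, hc, hcv'⟩ := mem_muAtoms_iff.1 hτ
  refine mem_muAtoms_iff.2 ⟨a, (strict_iff (cuts_sizeUpTo μ).monotone).2 ⟨hrun, fun b hb => ?_⟩,
    haw⟩
  -- Atoms of `π` share one length, so `a` has as many letters as the reduced `μ`-word `c` of `τ`.
  have h₁ := ((strict_iff (cuts_sizeUpTo μ).monotone).1 hc).2 b hb
  have h₂ := (hc.isAtom (cuts_sizeUpTo μ)).1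
  have h₃ := invCount_eq_of_mem_muAtoms hv hw
  have h₄ := hcv.2
  have h₅ := hcw.2
  rw [hcv'] at h₂
  simp only [permLength_eq] at h₄ h₅
  omega

/-- The choice in `muTransp` may rest on another atom `v'`, but then `v t_ij` is an atom of both
targets, and a permutation determines its state. -/
lemma muTransp_eq {π τ : MuInvolution μ} {v : Perm (Fin n)} {i j : Fin n}
    (hv : v ∈ muAtoms μ π) (hcv : BruhatCover v (v * swap i j))
    (hτ : v * swap i j ∈ muAtoms μ τ) : muTransp μ i j π = τ := by
  have hex : ∃ τ : MuInvolution μ, ∃ v ∈ muAtoms μ π,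
      BruhatCover v (v * swap i j) ∧ v * swap i j ∈ muAtoms μ τ := ⟨τ, v, hv, hcv, hτ⟩
  rw [muTransp, dif_pos hex]
  obtain ⟨v', hv', hcv', hτ'⟩ := hex.choose_spec
  have h := (isAtom_of_mem_muAtoms (mul_swap_mem_muAtoms hv' hv hcv' hcv hτ')).1
  exact Subtype.ext (muState_injective (h.eq (isAtom_of_mem_muAtoms hτ).1))

/-- Moving the deleted letter to the right end conjugates it by the letters it passes, which leaves
a transposition. -/
lemma exists_wordProd_eq_mul_swap {a b : List (Fin (n - 1))} (h : b.Sublist a)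
    (hl : b.length + 1 = a.length) : ∃ i j, wordProd a = wordProd b * swap i j := by
  induction a using List.reverseRecOn generalizing b with
  | nil => simp at hl
  | append_singleton a x ih =>
    rw [List.length_append, List.length_singleton] at hl
    obtain ⟨b₁, b₂, rfl, h₁, h₂⟩ := List.sublist_append_iff.1 h
    rcases List.sublist_singleton.1 h₂ with rfl | rfl
    · rw [List.append_nil] at hl ⊢
      rw [h₁.eq_of_length (by omega)]
      exact ⟨lowVal x, highVal x, wordProd_append_singleton _ _⟩
    · rw [List.length_append, List.length_singleton] at hl
      obtain ⟨i, j, hij⟩ := ih h₁ (by omega)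
      refine ⟨adjSwap x i, adjSwap x j, ?_⟩
      rw [wordProd_append_singleton, wordProd_append_singleton, hij, swap_apply_apply,
        adjSwap_inv]
      simp only [← mul_assoc]
      rw [mul_assoc (wordProd b₁) (adjSwap x) (adjSwap x), adjSwap_mul_self, mul_one]

lemma exists_muBruhatLE_between {π τ : MuInvolution μ} {a b : List (Fin (n - 1))}
    (ha : IsReducedMuWord μ a τ) (hb : IsReducedMuWord μ b π) (hba : b.Sublist a) (hne : π ≠ τ) :
    ∃ (ρ : MuInvolution μ) (c : List (Fin (n - 1))), IsReducedMuWord μ c ρ ∧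
      c.length + 1 = a.length ∧ MuBruhatLE μ π ρ ∧ MuBruhatLE μ ρ τ := by
  have hmono := (cuts_sizeUpTo μ).monotone
  have hle : muState μ π ≤ muState μ τ := by
    rw [← ha.1, ← hb.1, muState_muWordProd, muState_muWordProd]
    exact run_le_run_of_sublist hba
  have hlt : muState μ π < muState μ τ :=
    lt_of_le_of_ne hle fun e => hne (Subtype.ext (muState_injective e))
  have hLE : ∀ {π τ : MuInvolution μ}, muState μ π ≤ muState μ τ →
      (muState μ π).Rearranges (fun p => (μ.index p : ℕ)) → MuBruhatLE μ π τ := by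
    intro π τ h hr a ha
    obtain ⟨b, hb, hs⟩ := (isReducedMuWord_iff.1 ha).exists_sublist hmono
      (isMuInvolution_iff_valid.1 π.2) hr h
    exact ⟨b, hb, isReducedMuWord_iff.2 hs⟩
  have hπ := isReducedMuWord_iff.1 hb
  obtain ⟨ρ, c, hc, hlen, h₁, h₂⟩ := (isReducedMuWord_iff.1 ha).exists_corank_one hmono
    hπ.valid hπ.rearranges hlt
  have hρ : muState μ (muWordProd μ c) = ρ := by rw [muState_muWordProd, hc.run_eq]
  subst hρ
  exact ⟨⟨muWordProd μ c, isMuInvolution_muWordProd μ c⟩, c, isReducedMuWord_iff.2 hc, hlen,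
    hLE h₁ hπ.rearranges, hLE h₂ hc.rearranges⟩

lemma IsReducedMuWord.length_eq {π : MuInvolution μ} {a b : List (Fin (n - 1))}
    (ha : IsReducedMuWord μ a π) (hb : IsReducedMuWord μ b π) : a.length = b.length :=
  le_antisymm (ha.2 b hb.1) (hb.2 a ha.1)

end

theorem theorem3p10 (n : ℕ) (μ : Composition n) (π τ : MuInvolution μ)
    (h : MuBruhatCover μ π τ) :
    muAtoms μ τ =
      {u : Equiv.Perm (Fin n) | ∃ w ∈ muAtoms μ π, ∃ i j : Fin n,
        muTransp μ i j π = τ ∧ BruhatCover w (w * Equiv.swap i j) ∧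
          u = w * Equiv.swap i j} := by
  obtain ⟨hle, hne, hcov⟩ := h
  ext u
  constructor
  · rintro ⟨a, hau, ha⟩
    obtain ⟨b, hba, hb⟩ := hle a ha
    obtain ⟨ρ, c, hc, hlen, h₁, h₂⟩ := exists_muBruhatLE_between ha hb hba hne
    have hbl : b.length + 1 = a.length := by
      -- Reduced words of `ρ` are one letter shorter than those of `τ`, so `ρ` must be `π`.
      rcases hcov ρ h₁ h₂ with rfl | rfl
      · rw [hb.length_eq hc, hlen]
      · have := hc.length_eq ha
        omega
    obtain ⟨i, j, hij⟩ := exists_wordProd_eq_mul_swap hba hbl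
    have hw : wordProd b ∈ muAtoms μ π := mem_muAtoms_iff.2 ⟨b, isReducedMuWord_iff.1 hb, rfl⟩
    obtain rfl := hau.1
    have hcover : BruhatCover (wordProd b) (wordProd b * swap i j) := by
      refine ⟨⟨i, j, rfl⟩, ?_⟩
      rw [← hij, permLength_eq, permLength_eq, ← (isReducedWord_iff.1 hau).2, ← hbl,
        ((isReducedMuWord_iff.1 hb).isAtom (cuts_sizeUpTo μ)).1]
    exact ⟨wordProd b, hw, i, j, muTransp_eq hw hcover (hij ▸ ⟨a, hau, ha⟩), hcover, hij⟩
  · rintro ⟨w, hw, i, j, ht, hcw, rfl⟩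
    by_cases hex : ∃ τ : MuInvolution μ, ∃ v ∈ muAtoms μ π,
        BruhatCover v (v * swap i j) ∧ v * swap i j ∈ muAtoms μ τ
    · obtain ⟨τ', v, hv, hcv, hτ⟩ := hex
      rw [← ht, muTransp_eq hv hcv hτ]
      exact mul_swap_mem_muAtoms hv hw hcv hcw hτ
    -- Without a witness the operator takes its default value `π`, which differs from `τ`.
    · rw [muTransp, dif_neg hex] at ht
      exact absurd ht hne
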